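/- Let $\mathbb{F}$ be $\mathbb{R}$ or $\mathbb{C}$; Banach spaces are over $\mathbb{F}$, and rational scalars are the elements of $\mathbb{F}\cap\mathbb{Q}(i)$. Fix standard effective codings, by natural numbers, of rational numbers, rational scalars, finite sequences, pairs and finite sets of natural numbers. A \emph{presentation} $\mathcal{B}^\#=(\mathcal{B},R)$ of a Banach space $\mathcal{B}$ consists of $\mathcal{B}$ and a map $R:\mathbb{N}\to\mathcal{B}$ whose range has dense linear span. The $m$-th rational vector $\mathcal{R}(\mathcal{B}^\#;m)$ is $\sum_{j<M}\alpha_jR(j)$, where $m$ codes the sequence $\langle\alpha_0,\dots,\alpha_{M-1}\rangle$ of rational scalars; $B(\mathcal{B}^\#;n)$ is the $n$-th open ball with rational vector as center and positive rational radius, and $I_n$ is the $n$-th open interval of $\mathbb{R}$ with rational center and positive rational radius. A function $f\in\mathbb{N}^\mathbb{N}$ \emph{names} $\mathcal{B}^\#$ if the range of $f$ is the set of (codes of) pairs $(m,n)$ with $\|\mathcal{R}(\mathcal{B}^\#;m)\|\in I_n$. A function $h\in\mathbb{N}^\mathbb{N}$ \emph{names} the real $p$ if for every $k$ the rational number $q_k$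 coded by $h(k)$ satisfies $|q_k-p|<2^{-k}$. Let $1\le p<\infty$. Vectors $v_1,\dots,v_n\in\mathcal{B}$ are \emph{$L^p$-formally disjointly supported} if $\|\sum_j\alpha_jv_j\|^p=\sum_j|\alpha_j|^p\|v_j\|^p$ for all scalars $\alpha_1,\dots,\alpha_n\in\mathbb{F}$. A \emph{vector tree} of $\mathcal{B}$ is an injective map $\phi:S\to\mathcal{B}$ where $S\subseteq\mathbb{N}^{<\mathbb{N}}$ is a (possibly empty) set of finite sequences closed under initial segments. It is an \emph{$L^p$-formal disintegration} of $\mathcal{B}$ if (i) for every nonterminal $\nu\in S$, $\phi(\nu)=\sum_{\nu'}\phi(\nu')$ (unconditional convergence), where $\nu'$ ranges over the children of $\nu$ in $S$; (ii) $\phi(\nu_0),\dots,\phi(\nu_n)$ are $L^p$-formally disjointly supported whenever $\nu_0,\dots,\nu_n\in S$ are pairwise incomparable; (iii) $\phi(\nu)\ne\mathbf{0}$ for all $\nu\in S$; (iv) the linear span of $\phi[S]$ is dense in $\mathcal{B}$. A function $g\in\mathbb{N}^\mathbb{N}$ \emph{names} the vector tree $\phi$ of $\mathcal{B}^\#$ if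 the range of $g$ is the set of codes of the finite subsets of $\{(\nu,n) : \nu\in S,\ \phi(\nu)\in B(\mathcal{B}^\#;n)\}$. A predicate $P\subseteq(\mathbb{N}^\mathbb{N})^3$ is $\Pi^0_2$ if there is a computable predicate $Q\subseteq(\mathbb{N}^\mathbb{N})^3\times\mathbb{N}^2$ (decided by one oracle machine that halts for all oracles and inputs) such that $P(f,g,h)\Leftrightarrow\forall x\,\exists y\,Q(f,g,h;x,y)$ for all $f,g,h$. \textbf{Theorem.} There is a $\Pi^0_2$ predicate $\operatorname{Disint}\subseteq(\mathbb{N}^\mathbb{N})^3$ such that for all $f,g,h\in\mathbb{N}^\mathbb{N}$, if $f$ names a Banach space presentation $\mathcal{B}^\#$ and $h$ names a real $p\ge1$, then $\operatorname{Disint}(f,g,h)$ holds if and only if $g$ names an $L^p$-formal disintegration of $\mathcal{B}^\#$. -/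

import Mathlib

namespace FormalDisint

/-! ### Computable functionals and `Π⁰₂` predicates on `(ℕ → ℕ)^k` -/

/-- Partial computable functionals `Φ(F; n)` of a tuple `F = (F 0, …, F (k-1))` of elements of `ℕ → ℕ`
and a number `n`.  A derivation is an oracle program; it does not depend on the oracles `F i`, which
it may query.  (For each fixed `F` the clauses are those of `Nat.RecursiveIn`.) -/
inductive PartrecFunctional {k : ℕ} : ((Fin k → ℕ → ℕ) → ℕ →. ℕ) → Prop
  | zero : PartrecFunctional fun _ _ => Part.some 0
  | succ : PartrecFunctional fun _ n => Part.some (n + 1)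
  | left : PartrecFunctional fun _ n => Part.some n.unpair.1
  | right : PartrecFunctional fun _ n => Part.some n.unpair.2
  | oracle (i : Fin k) : PartrecFunctional fun F n => Part.some (F i n)
  | pair {Φ Ψ : (Fin k → ℕ → ℕ) → ℕ →. ℕ} (hΦ : PartrecFunctional Φ) (hΨ : PartrecFunctional Ψ) :
      PartrecFunctional fun F n => Nat.pair <$> Φ F n <*> Ψ F n
  | comp {Φ Ψ : (Fin k → ℕ → ℕ) → ℕ →. ℕ} (hΦ : PartrecFunctional Φ) (hΨ : PartrecFunctional Ψ) :
      PartrecFunctional fun F n => Ψ F n >>= Φ F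
  | prec {Φ Ψ : (Fin k → ℕ → ℕ) → ℕ →. ℕ} (hΦ : PartrecFunctional Φ) (hΨ : PartrecFunctional Ψ) :
      PartrecFunctional fun F n =>
        n.unpair.2.rec (Φ F n.unpair.1) fun y IH => do
          let i ← IH
          Ψ F (Nat.pair n.unpair.1 (Nat.pair y i))
  | rfind {Φ : (Fin k → ℕ → ℕ) → ℕ →. ℕ} (hΦ : PartrecFunctional Φ) :
      PartrecFunctional fun F a =>
        Nat.rfind fun n => (fun m => decide (m = 0)) <$> Φ F (Nat.pair a n)

/-- `Q ⊆ (ℕ → ℕ)^k × ℕ²` is computable: one oracle program decides it, halting on every input and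
for all oracles. -/
def IsComputablePred {k : ℕ} (Q : (Fin k → ℕ → ℕ) → ℕ → ℕ → Prop) : Prop :=
  ∃ Φ : (Fin k → ℕ → ℕ) → ℕ →. ℕ, PartrecFunctional Φ ∧ ∀ F x y,
    (Q F x y → Φ F (Nat.pair x y) = Part.some 1) ∧ (¬ Q F x y → Φ F (Nat.pair x y) = Part.some 0)

/-- `P ⊆ (ℕ → ℕ)^k` is (lightface) `Π⁰₂`. -/
def IsPi02 {k : ℕ} (P : (Fin k → ℕ → ℕ) → Prop) : Prop :=
  ∃ Q : (Fin k → ℕ → ℕ) → ℕ → ℕ → Prop, IsComputablePred Q ∧ ∀ F, P F ↔ ∀ x, ∃ y, Q F x y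

/-! ### Standard codings -/

/-- The `n`-th rational number (in an effective enumeration with repetitions). -/
def ratCode (n : ℕ) : ℚ := (Denumerable.ofNat ℤ n.unpair.1 : ℚ) / ((n.unpair.2 : ℚ) + 1)

/-- The `n`-th positive rational number. -/
def posRatCode (n : ℕ) : ℚ := ((n.unpair.1 : ℚ) + 1) / ((n.unpair.2 : ℚ) + 1)

/-- The `n`-th rational scalar of `𝕜`, i.e. the `n`-th element of `𝕜 ∩ ℚ(i)`.
(For `𝕜 = ℝ` one has `RCLike.I = 0`, and this is a rational number.) -/
noncomputable def scalarCode (𝕜 : Type*) [RCLike 𝕜] (n : ℕ) : 𝕜 :=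
  ((ratCode n.unpair.1 : ℚ) : 𝕜) + ((ratCode n.unpair.2 : ℚ) : 𝕜) * RCLike.I

/-- The `n`-th open rational interval `I_n` of `ℝ`. -/
def ratInterval (n : ℕ) : Set ℝ :=
  Metric.ball ((ratCode n.unpair.1 : ℚ) : ℝ) ((posRatCode n.unpair.2 : ℚ) : ℝ)

/-- Canonical indices of finite sets of numbers: `k` codes the finite set of the positions of the
digit `1` in the binary expansion of `k`. -/
def finiteSetCode (k : ℕ) : Set ℕ := {i | k.testBit i = true}

/-- `h` names the real `x`: it lists (codes of) rational numbers with `|q_k - x| < 2^{-k}`. -/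
def NamesReal (h : ℕ → ℕ) (x : ℝ) : Prop :=
  ∀ k : ℕ, |((ratCode (h k) : ℚ) : ℝ) - x| < (2 : ℝ)⁻¹ ^ k

section Banach

variable (𝕜 : Type*) [RCLike 𝕜] {B : Type*} [NormedAddCommGroup B] [NormedSpace 𝕜 B]

/-! ### Presentations of Banach spaces and their names -/

/-- The linear span of `s` is dense. -/
def LinearlyDense (s : Set B) : Prop := Dense (Submodule.span 𝕜 s : Set B)

/-- `R` is a structure on `B`, so that `(B, R)` is a presentation with distinguished points `R n`. -/
def IsPresentation (R : ℕ → B) : Prop := LinearlyDense 𝕜 (Set.range R)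

/-- The `n`-th rational vector `∑_{j < M} α_j R(j)` of the presentation `(B, R)`, where `n` codes the
list `⟨α_0, …, α_{M-1}⟩` of rational scalars. -/
noncomputable def ratVec (R : ℕ → B) (n : ℕ) : B :=
  ∑ j : Fin (Denumerable.ofNat (List ℕ) n).length,
    scalarCode 𝕜 ((Denumerable.ofNat (List ℕ) n).get j) • R j

/-- The `n`-th open rational ball of the presentation `(B, R)`. -/
def ratBall (R : ℕ → B) (n : ℕ) : Set B :=
  Metric.ball (ratVec 𝕜 R n.unpair.1) ((posRatCode n.unpair.2 : ℚ) : ℝ)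

/-- The diagram of `(B, R)`: all (codes of) pairs `(m, n)` such that the norm of the `m`-th rational
vector lies in the `n`-th rational interval. -/
def diagram (R : ℕ → B) : Set ℕ := {i | ‖ratVec 𝕜 R i.unpair.1‖ ∈ ratInterval i.unpair.2}

/-- `f` names the presentation `(B, R)`: it enumerates its diagram. -/
def NamesPresentation (f : ℕ → ℕ) (R : ℕ → B) : Prop := Set.range f = diagram 𝕜 R

/-! ### Formal disintegrations and their names -/

/-- `v_1, …, v_n` are `L^p`-formally disjointly supported. -/
def FormallyDisjoint (p : ℝ) {n : ℕ} (v : Fin n → B) : Prop :=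
  ∀ α : Fin n → 𝕜, ‖∑ j, α j • v j‖ ^ p = ∑ j, ‖α j‖ ^ p * ‖v j‖ ^ p

/-- A vector tree of `B`: an injective map into `B` from a tree, i.e. a (possibly empty) set of finite
sequences closed under initial segments.  Only the values of `vec` on `dom` are meaningful. -/
structure VectorTree (B : Type*) where
  dom : Set (List ℕ)
  vec : List ℕ → B
  isTree : ∀ ν ∈ dom, ∀ μ : List ℕ, μ <+: ν → μ ∈ dom
  inj : Set.InjOn vec dom

namespace VectorTree

/-- The children of `ν` in the tree `dom φ`. -/
def children (φ : VectorTree B) (ν : List ℕ) : Set (List ℕ) := {μ | μ ∈ φ.dom ∧ ∃ a, μ = ν ++ [a]}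

/-- Every vector at a nonterminal node is the (unconditional) sum of the vectors at its children. -/
def Summative (φ : VectorTree B) : Prop :=
  ∀ ν ∈ φ.dom, (φ.children ν).Nonempty → HasSum (fun μ : φ.children ν => φ.vec μ) (φ.vec ν)

/-- The vectors at pairwise incomparable nodes are `L^p`-formally disjointly supported. -/
def FormallySeparating (p : ℝ) (φ : VectorTree B) : Prop :=
  ∀ (n : ℕ) (ν : Fin n → List ℕ), (∀ j, ν j ∈ φ.dom) → (∀ i j, i ≠ j → ¬ ν i <+: ν j) →
    FormallyDisjoint 𝕜 p fun j => φ.vec (ν j)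

/-- `φ` is an `L^p`-formal disintegration of `B`. -/
structure IsFormalDisintegration (p : ℝ) (φ : VectorTree B) : Prop where
  summative : φ.Summative
  separating : φ.FormallySeparating 𝕜 p
  omits_zero : ∀ ν ∈ φ.dom, φ.vec ν ≠ 0
  dense : LinearlyDense 𝕜 (φ.vec '' φ.dom)

/-- The set of all (codes of) pairs `(ν, n)` such that `φ(ν)` lies in the `n`-th rational ball of the
presentation `(B, R)`. -/
def graphCodes (φ : VectorTree B) (R : ℕ → B) : Set ℕ :=
  {i | Denumerable.ofNat (List ℕ) i.unpair.1 ∈ φ.dom ∧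
    φ.vec (Denumerable.ofNat (List ℕ) i.unpair.1) ∈ ratBall 𝕜 R i.unpair.2}

/-- `g` names the vector tree `φ` of the presentation `(B, R)`: it enumerates the (codes of) finite
sets of pairs `(ν, n)` such that `φ(ν)` lies in the `n`-th rational ball. -/
def Names (g : ℕ → ℕ) (φ : VectorTree B) (R : ℕ → B) : Prop :=
  Set.range g = {k | finiteSetCode k ⊆ φ.graphCodes 𝕜 R}

end VectorTree

end Banach

end FormalDisint

/-! The predicate is a finite conjunction of conditions of the form "for all `a`, if `A(F, a)` then
`C(F, a)`", where `F = (f, g, h)`, `a` ranges over a coded type and both `A` and `C` are `Σ⁰₁`. Such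
a conjunction is `Π⁰₂` (`IsPi.forall_imp`, `IsPi.isPi02`). `Σ⁰₁` is taken to mean that some finite
initial segment of `F` satisfies a primitive recursive relation, so oracles enter only through the
computation of initial segments.

That `g` names a vector tree is expressed by the balls it lists at each node. They are exactly the
rational balls around one vector when they are arbitrarily small, pairwise compatible, closed under
formal enlargement, and each formally contains another listed ball. Completeness supplies the vector
as the limit of the centers (`exists_vec_of_treeNameCond`). The range of `g` consists of all codes
of finite sets of listed pairs once it contains the empty set and is closed under adjoining a larger
listed element (`names_iff`).

The axioms of a disintegration are then read off from the norms of rational combinations of tree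
vectors and rational vectors. An estimate of such a norm by rational numbers is `Σ⁰₁`
(`isSigma_combNorm`, `combNorm_iff`). Nonvanishing and injectivity are positivity of a norm. Density
asks for arbitrarily good approximations of rational vectors.

Two axioms need an idea. Formal disjointness is an equality between powers with a real exponent `p`.
By density it suffices to use rational scalars, and the equality holds if and only if it holds
approximately to every precision with rational exponents `a / (b + 1)` close to `p` and with norms
replaced by powers `s ^ (b + 1)`, since then all powers that occur are the rational numbers `s ^ a`
(`exists_pow_approx`, `pow_eq_of_approx`). Unconditional convergence, written out, has one
quantifier alternation too many. Formal disjointness, however, makes the norms of finite sums of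
children increase with the index set, so a cluster point of the net of finite sums is already its
limit (`hasSum_of_norm_sum_mono`). Being a cluster point is a condition of the permitted form. -/

namespace FormalDisint

open Encodable

/-! ### Uniformly primitive recursive functionals -/

/-- A total functional `g(F; n)` that is computed by one oracle program. -/
def TotalFunctional {k : ℕ} (g : (Fin k → ℕ → ℕ) → ℕ → ℕ) : Prop :=
  PartrecFunctional fun F n => Part.some (g F n)

namespace TotalFunctional

variable {k : ℕ} {g h : (Fin k → ℕ → ℕ) → ℕ → ℕ}

theorem of_eq (hg : TotalFunctional g) (H : ∀ F n, g F n = h F n) : TotalFunctional h := by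
  have : g = h := funext fun F => funext (H F)
  rwa [← this]

theorem pair (hg : TotalFunctional g) (hh : TotalFunctional h) :
    TotalFunctional fun F n => Nat.pair (g F n) (h F n) := by
  have := PartrecFunctional.pair hg hh
  simpa [TotalFunctional, Seq.seq] using this

theorem comp (hg : TotalFunctional g) (hh : TotalFunctional h) :
    TotalFunctional fun F n => g F (h F n) := by
  have := PartrecFunctional.comp hg hh
  simpa [TotalFunctional] using this

theorem prec (hg : TotalFunctional g) (hh : TotalFunctional h) :
    TotalFunctional fun F n => n.unpair.2.rec (g F n.unpair.1)
      fun y IH => h F (Nat.pair n.unpair.1 (Nat.pair y IH)) := by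
  have := PartrecFunctional.prec hg hh
  unfold TotalFunctional
  refine iff_of_eq (congrArg _ (funext₂ fun F n => ?_)) |>.2 this
  beta_reduce
  induction n.unpair.2 with
  | zero => rfl
  | succ m ih => simp only [← ih]; simp

/-- All oracle-free work is delegated to primitive recursive functions through this lemma. -/
theorem of_nat_primrec {f : ℕ → ℕ} (hf : Nat.Primrec f) :
    TotalFunctional (k := k) fun _ n => f n := by
  induction hf with
  | zero => exact PartrecFunctional.zero
  | succ => exact PartrecFunctional.succ
  | left => exact PartrecFunctional.left
  | right => exact PartrecFunctional.right
  | pair _ _ hf hg => exact hf.pair hg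
  | comp _ _ hf hg => exact TotalFunctional.comp hf hg
  | prec _ _ hf hg =>
    exact (hf.prec hg).of_eq fun F n => by simp [Nat.unpaired]

theorem oracle (i : Fin k) : TotalFunctional fun F n => F i n := PartrecFunctional.oracle i

end TotalFunctional

theorem exists_lt_of_primrecRel {γ : Type*} [Primcodable γ] {S : ℕ → γ → Prop}
    (hS : PrimrecRel S) : PrimrecRel fun n c => ∃ x < n, S x c :=
  (hS.exists_mem_list.comp (Primrec.list_range.comp Primrec.fst) Primrec.snd).of_eq (by simp)

/-! ### `Σ⁰₁` predicates of three functions and an element of a coded type -/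

/-- The first `y` values of three functions. -/
def initSeg (F : Fin 3 → ℕ → ℕ) (y : ℕ) : List (ℕ × ℕ × ℕ) :=
  (List.range y).map fun i => (F 0 i, F 1 i, F 2 i)

@[simp]
theorem length_initSeg (F : Fin 3 → ℕ → ℕ) (y : ℕ) : (initSeg F y).length = y := by
  simp [initSeg]

theorem take_initSeg (F : Fin 3 → ℕ → ℕ) {y z : ℕ} (h : z ≤ y) :
    (initSeg F y).take z = initSeg F z := by
  simp [initSeg, ← List.map_take, List.take_range, h]

theorem initSeg_getElem? (F : Fin 3 → ℕ → ℕ) {y z : ℕ} :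
    (initSeg F y)[z]? = if z < y then some (F 0 z, F 1 z, F 2 z) else none := by
  by_cases h : z < y <;> simp [initSeg, h]

theorem initSeg_succ (F : Fin 3 → ℕ → ℕ) (y : ℕ) :
    initSeg F (y + 1) = initSeg F y ++ [(F 0 y, F 1 y, F 2 y)] := by
  simp [initSeg, List.range_succ]

/-- A primitive recursion that appends one triple of oracle values at each step. Every later use of
the oracles goes through these segments. -/
theorem totalFunctional_initSeg : TotalFunctional fun F n => encode (initSeg F n) := by
  have step : Primrec fun n : ℕ =>
      encode (Denumerable.ofNat (List (ℕ × ℕ × ℕ)) n.unpair.1 ++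
        [Denumerable.ofNat (ℕ × ℕ × ℕ) n.unpair.2]) :=
    Primrec.encode.comp (Primrec.list_append.comp
      ((Primrec.ofNat _).comp (Primrec.fst.comp Primrec.unpair))
      (Primrec.list_cons.comp ((Primrec.ofNat _).comp (Primrec.snd.comp Primrec.unpair))
        (Primrec.const [])))
  have hy : TotalFunctional (k := 3) fun _ n => n.unpair.2.unpair.1 :=
    TotalFunctional.of_nat_primrec (Nat.Primrec.left.comp Nat.Primrec.right)
  have hIH : TotalFunctional (k := 3) fun _ n => n.unpair.2.unpair.2 :=
    TotalFunctional.of_nat_primrec (Nat.Primrec.right.comp Nat.Primrec.right)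
  have key := ((TotalFunctional.of_nat_primrec (k := 3) (Nat.Primrec.const (encode
      ([] : List (ℕ × ℕ × ℕ))))).prec
    ((TotalFunctional.of_nat_primrec (Primrec.nat_iff.1 step)).comp
      (hIH.pair (((TotalFunctional.oracle 0).comp hy).pair
        (((TotalFunctional.oracle 1).comp hy).pair ((TotalFunctional.oracle 2).comp hy)))))).comp
    -- The recursion scheme expects a pair of parameter and counter; the parameter is a dummy `0`.
    (TotalFunctional.of_nat_primrec (Nat.Primrec.pair Nat.Primrec.zero Nat.Primrec.id))
  refine key.of_eq fun F n => ?_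
  simp only [Nat.unpair_pair, id]
  induction n with
  | zero => simp [initSeg]
  | succ n ih =>
    simp only [ih, initSeg_succ, Denumerable.ofNat_encode]
    simp

section SigmaPi

variable {α β : Type*} [Primcodable α] [Primcodable β]

/-- `P ⊆ (ℕ → ℕ)³ × α` is `Σ⁰₁`. -/
def IsSigma (P : (Fin 3 → ℕ → ℕ) → α → Prop) : Prop :=
  ∃ S : α → List (ℕ × ℕ × ℕ) → Prop, PrimrecRel S ∧ ∀ F a, P F a ↔ ∃ y, S a (initSeg F y)

namespace IsSigma

variable {P P' : (Fin 3 → ℕ → ℕ) → α → Prop}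

theorem of_eq (h : IsSigma P) (H : ∀ F a, P F a ↔ P' F a) : IsSigma P' := by
  obtain ⟨S, hS, h⟩ := h
  exact ⟨S, hS, fun F a => (H F a).symm.trans (h F a)⟩

theorem comp (h : IsSigma P) {f : β → α} (hf : Primrec f) : IsSigma fun F b => P F (f b) := by
  obtain ⟨S, hS, h⟩ := h
  exact ⟨fun b l => S (f b) l, hS.comp (hf.comp Primrec.fst) Primrec.snd, fun F b => h F (f b)⟩

theorem of_primrec {p : α → Prop} (hp : PrimrecPred p) : IsSigma fun _ a => p a :=
  ⟨fun a _ => p a, hp.comp Primrec.fst, fun F a => by simp⟩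

/-- Dovetailing: the length of the segment is read as a pair of the code of a witness and the stage
at which it is verified. The relation `S` need not persist on longer segments, so the segment is cut
back to that stage, which never exceeds the length. -/
theorem exists' {P : (Fin 3 → ℕ → ℕ) → α × β → Prop} (h : IsSigma P) :
    IsSigma fun F a => ∃ b, P F (a, b) := by
  obtain ⟨S, hS, h⟩ := h
  refine ⟨fun a l => ∃ b ∈ (decode (α := β) l.length.unpair.1).toList,
    S (a, b) (l.take l.length.unpair.2), ?_, fun F a => ?_⟩
  · have hrel : PrimrecRel fun (b : β) (q : α × List (ℕ × ℕ × ℕ)) =>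
        S (q.1, b) (q.2.take q.2.length.unpair.2) :=
      hS.comp (Primrec.pair (Primrec.fst.comp Primrec.snd) Primrec.fst)
        (Primrec.list_take.comp (Primrec.snd.comp (Primrec.unpair.comp (Primrec.list_length.comp
          (Primrec.snd.comp Primrec.snd)))) (Primrec.snd.comp Primrec.snd))
    exact hrel.exists_mem_list.comp (Primrec.optionToList.comp (Primrec.decode.comp
      (Primrec.fst.comp (Primrec.unpair.comp (Primrec.list_length.comp Primrec.snd))))) Primrec.id
  · simp only [h, length_initSeg]
    constructor
    · rintro ⟨b, y, hy⟩
      refine ⟨Nat.pair (encode b) y, b, by simp, ?_⟩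
      rwa [take_initSeg, Nat.unpair_pair]
      exact Nat.unpair_right_le _
    · rintro ⟨w, b, _, hb⟩
      rw [take_initSeg _ (Nat.unpair_right_le _)] at hb
      exact ⟨b, _, hb⟩

theorem and (h : IsSigma P) (h' : IsSigma P') : IsSigma fun F a => P F a ∧ P' F a := by
  obtain ⟨S, hS, h⟩ := h
  obtain ⟨S', hS', h'⟩ := h'
  refine ⟨fun a l => S a (l.take l.length.unpair.1) ∧ S' a (l.take l.length.unpair.2),
    ?_, fun F a => ?_⟩
  · have hl := Primrec.unpair.comp (Primrec.list_length.comp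
      (Primrec.snd (α := α) (β := List (ℕ × ℕ × ℕ))))
    exact (hS.comp Primrec.fst (Primrec.list_take.comp (Primrec.fst.comp hl) Primrec.snd)).and
      (hS'.comp Primrec.fst (Primrec.list_take.comp (Primrec.snd.comp hl) Primrec.snd))
  · simp only [h, h', length_initSeg, take_initSeg _ (Nat.unpair_right_le _),
      take_initSeg _ (Nat.unpair_left_le _)]
    constructor
    · rintro ⟨⟨y, hy⟩, z, hz⟩
      exact ⟨Nat.pair y z, by simpa using ⟨hy, hz⟩⟩
    · rintro ⟨w, hy, hz⟩
      exact ⟨⟨_, hy⟩, _, hz⟩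

theorem forall_mem {P : (Fin 3 → ℕ → ℕ) → α × β → Prop} (h : IsSigma P) {l : α → List β}
    (hl : Primrec l) : IsSigma fun F a => ∀ b ∈ l a, P F (a, b) := by
  obtain ⟨S, hS, h⟩ := h
  refine ⟨fun a s => ∀ b ∈ l a, ∃ z < s.length + 1, S (a, b) (s.take z), ?_, fun F a => ?_⟩
  · have h1 : PrimrecRel fun (z : ℕ) (q : β × α × List (ℕ × ℕ × ℕ)) =>
        S (q.2.1, q.1) (q.2.2.take z) :=
      hS.comp (Primrec.pair (Primrec.fst.comp (Primrec.snd.comp Primrec.snd))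
        (Primrec.fst.comp Primrec.snd))
        (Primrec.list_take.comp Primrec.fst (Primrec.snd.comp (Primrec.snd.comp Primrec.snd)))
    have h2 : PrimrecRel fun (b : β) (q : α × List (ℕ × ℕ × ℕ)) =>
        ∃ z < q.2.length + 1, S (q.1, b) (q.2.take z) :=
      PrimrecRel.comp (g := fun q : β × α × List (ℕ × ℕ × ℕ) => q) (exists_lt_of_primrecRel h1)
        (Primrec.succ.comp (Primrec.list_length.comp (Primrec.snd.comp Primrec.snd))) Primrec.id
    exact h2.forall_mem_list.comp (hl.comp Primrec.fst) Primrec.id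
  · simp only [h, length_initSeg]
    constructor
    · intro H
      choose! y hy using H
      -- The sum of the stages is a common bound for the stages of all members of the list.
      refine ⟨((l a).map y).sum, fun b hb => ⟨y b, ?_, ?_⟩⟩
      · exact Nat.lt_succ_of_le (List.le_sum_of_mem (List.mem_map_of_mem hb))
      · rw [take_initSeg _ (List.le_sum_of_mem (List.mem_map_of_mem hb))]
        exact hy b hb
    · rintro ⟨w, hw⟩ b hb
      obtain ⟨z, hz, hS⟩ := hw b hb
      rw [take_initSeg _ (Nat.lt_succ_iff.1 hz)] at hS
      exact ⟨z, hS⟩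

theorem oracle (i : Fin 3) : IsSigma fun F (a : ℕ × ℕ) => F i a.1 = a.2 := by
  have hg : Primrec fun q : (ℕ × ℕ) × List (ℕ × ℕ × ℕ) => q.2[q.1.1]? :=
    Primrec.list_getElem?.comp Primrec.snd (Primrec.fst.comp Primrec.fst)
  have hm := Primrec.snd.comp (Primrec.fst (α := ℕ × ℕ) (β := List (ℕ × ℕ × ℕ)))
  have key : ∀ (c : ℕ × ℕ × ℕ → ℕ), Primrec c → (∀ (F : Fin 3 → ℕ → ℕ) (n : ℕ), F i n = c (F 0 n, F 1 n, F 2 n)) →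
      IsSigma fun F (a : ℕ × ℕ) => F i a.1 = a.2 := fun c hc H => by
    refine ⟨fun a l => l[a.1]?.map c = some a.2, Primrec.eq.comp (Primrec.option_map hg
      (hc.comp Primrec.snd)) (Primrec.option_some.comp hm), fun F a => ?_⟩
    simp only [initSeg_getElem?]
    constructor
    · intro h
      exact ⟨a.1 + 1, by simp [← h, H]⟩
    · rintro ⟨y, hy⟩
      split_ifs at hy
      · simpa [H] using hy
      · simp at hy
  match i with
  | 0 => exact key _ Primrec.fst fun _ _ => rfl
  | 1 => exact key _ (Primrec.fst.comp Primrec.snd) fun _ _ => rfl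
  | 2 => exact key _ (Primrec.snd.comp Primrec.snd) fun _ _ => rfl

end IsSigma

/-- `P ⊆ (ℕ → ℕ)³` is a countable intersection of uniformly `Σ⁰₁` predicates. -/
def IsPi (P : (Fin 3 → ℕ → ℕ) → Prop) : Prop :=
  ∃ S : (Fin 3 → ℕ → ℕ) → ℕ → Prop, IsSigma S ∧ ∀ F, P F ↔ ∀ x, S F x

namespace IsPi

variable {P P' : (Fin 3 → ℕ → ℕ) → Prop}

theorem and (h : IsPi P) (h' : IsPi P') : IsPi fun F => P F ∧ P' F := by
  obtain ⟨S, hS, h⟩ := h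
  obtain ⟨S', hS', h'⟩ := h'
  exact ⟨fun F x => S F x ∧ S' F x, hS.and hS', fun F => by simp [h, h', forall_and]⟩

/-- The universal variable is enlarged to a pair of `a` and a stage `s`. The instance says that if
stage `s` verifies the premise, then some stage verifies the conclusion; the premise at a fixed
stage is decidable, so this is `Σ⁰₁`. Numbers that code no `a` impose nothing. -/
theorem forall_imp {A C : (Fin 3 → ℕ → ℕ) → α → Prop} (hA : IsSigma A) (hC : IsSigma C) :
    IsPi fun F => ∀ a, A F a → C F a := by
  obtain ⟨S, hS, hA⟩ := hA
  obtain ⟨T, hT, hC⟩ := hC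
  -- The bound on `y` ensures that the segment is long enough to evaluate the premise at its stage.
  refine ⟨fun F x => ∃ y, x.unpair.2 ≤ y ∧ ∀ a ∈ (decode (α := α) x.unpair.1).toList,
    S a (initSeg F x.unpair.2) → ∃ z ≤ y, T a (initSeg F z), ?_, fun F => ?_⟩
  · refine ⟨fun x l => x.unpair.2 ≤ l.length ∧ ∀ a ∈ (decode (α := α) x.unpair.1).toList,
      ¬ S a (l.take x.unpair.2) ∨ ∃ z < l.length + 1, T a (l.take z), ?_, fun F x => ?_⟩
    · have h1 : PrimrecRel fun (z : ℕ) (q : α × ℕ × List (ℕ × ℕ × ℕ)) =>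
          T q.1 (q.2.2.take z) :=
        hT.comp (Primrec.fst.comp Primrec.snd)
          (Primrec.list_take.comp Primrec.fst (Primrec.snd.comp (Primrec.snd.comp Primrec.snd)))
      have h2 : PrimrecRel fun (a : α) (q : ℕ × List (ℕ × ℕ × ℕ)) =>
          ¬ S a (q.2.take q.1.unpair.2) ∨ ∃ z < q.2.length + 1, T a (q.2.take z) :=
        PrimrecPred.or (PrimrecPred.not (hS.comp Primrec.fst (Primrec.list_take.comp
          (Primrec.snd.comp (Primrec.unpair.comp (Primrec.fst.comp Primrec.snd)))
          (Primrec.snd.comp Primrec.snd))))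
          (PrimrecRel.comp (g := fun q : α × ℕ × List (ℕ × ℕ × ℕ) => q) (exists_lt_of_primrecRel h1)
            (Primrec.succ.comp (Primrec.list_length.comp (Primrec.snd.comp Primrec.snd)))
            Primrec.id)
      exact PrimrecPred.and (Primrec.nat_le.comp (Primrec.snd.comp (Primrec.unpair.comp Primrec.fst))
        (Primrec.list_length.comp Primrec.snd))
        (h2.forall_mem_list.comp (Primrec.optionToList.comp (Primrec.decode.comp
          (Primrec.fst.comp (Primrec.unpair.comp Primrec.fst)))) Primrec.id)
    · simp only [length_initSeg]
      refine exists_congr fun y => and_congr_right fun hy => forall₂_congr fun a _ => ?_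
      rw [take_initSeg _ hy, imp_iff_not_or]
      refine or_congr Iff.rfl (exists_congr fun z => ?_)
      rw [Nat.lt_succ_iff]
      exact and_congr_right fun hz => by rw [take_initSeg _ hz]
  · simp only [hA, hC]
    constructor
    · intro H x
      rcases hd : decode (α := α) x.unpair.1 with _ | a
      · exact ⟨_, le_rfl, by simp⟩
      · by_cases hs : S a (initSeg F x.unpair.2)
        · obtain ⟨z, hz⟩ := H a ⟨_, hs⟩
          refine ⟨max x.unpair.2 z, le_max_left _ _, ?_⟩
          simpa using fun _ => ⟨z, Or.inr le_rfl, hz⟩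
        · exact ⟨_, le_rfl, by simp [hs]⟩
    · rintro H a ⟨s, hs⟩
      obtain ⟨y, _, h⟩ := H (Nat.pair (encode a) s)
      obtain ⟨z, _, hz⟩ := h a (by simp) (by simpa using hs)
      exact ⟨z, hz⟩

theorem isPi02 (h : IsPi P) : IsPi02 P := by
  classical
  obtain ⟨S, ⟨T, hT, hS⟩, h⟩ := h
  refine ⟨fun F x y => T x (initSeg F y), ?_, fun F => by simp [h, hS]⟩
  have hc : Primrec fun n : ℕ => if T n.unpair.1
      (Denumerable.ofNat (List (ℕ × ℕ × ℕ)) n.unpair.2) then 1 else 0 :=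
    Primrec.ite (hT.comp (Primrec.fst.comp Primrec.unpair)
      ((Primrec.ofNat _).comp (Primrec.snd.comp Primrec.unpair))) (Primrec.const 1)
      (Primrec.const 0)
  have hl : TotalFunctional (k := 3) fun _ n => n.unpair.1 := PartrecFunctional.left
  have hr : TotalFunctional (k := 3) fun _ n => n.unpair.2 := PartrecFunctional.right
  refine ⟨_, (TotalFunctional.of_nat_primrec (Primrec.nat_iff.1 hc)).comp
    (hl.pair (totalFunctional_initSeg.comp hr)), fun F x y => ?_⟩
  simp only [Nat.unpair_pair, Denumerable.ofNat_encode]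
  constructor <;> intro hq <;> simp [hq]

end IsPi

end SigmaPi

section RationalFunctions

variable {α β : Type*} [Primcodable α] [Primcodable β]

/-! ### Primitive recursive functions with rational values -/

/-- `f : α → ℚ` is primitive recursive (as a difference of numerators over a denominator). -/
def PrimrecRat (f : α → ℚ) : Prop :=
  ∃ a b d : α → ℕ, Primrec a ∧ Primrec b ∧ Primrec d ∧
    ∀ x, f x = ((a x : ℚ) - b x) / ((d x : ℚ) + 1)

/-- Even codes belong to the nonnegative integers, odd codes to the negative ones, so that `ratCode`
is accessible to arithmetic on codes. -/
theorem ofNat_int_two_mul (n : ℕ) : Denumerable.ofNat ℤ (2 * n) = n := by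
  have : encode (n : ℤ) = 2 * n := rfl
  rw [← this, Denumerable.ofNat_encode]

theorem ofNat_int_two_mul_add_one (n : ℕ) : Denumerable.ofNat ℤ (2 * n + 1) = -(n + 1 : ℤ) := by
  have : encode (Int.negSucc n) = 2 * n + 1 := rfl
  rw [← this, Denumerable.ofNat_encode, Int.negSucc_eq]

namespace PrimrecRat

variable {f g : α → ℚ}

theorem of_eq (hf : PrimrecRat f) (H : ∀ x, f x = g x) : PrimrecRat g := by
  obtain ⟨a, b, d, ha, hb, hd, h⟩ := hf
  exact ⟨a, b, d, ha, hb, hd, fun x => (H x).symm.trans (h x)⟩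

theorem comp (hf : PrimrecRat f) {k : β → α} (hk : Primrec k) : PrimrecRat fun x => f (k x) := by
  obtain ⟨a, b, d, ha, hb, hd, h⟩ := hf
  exact ⟨_, _, _, ha.comp hk, hb.comp hk, hd.comp hk, fun x => h (k x)⟩

theorem natCast {k : α → ℕ} (hk : Primrec k) : PrimrecRat fun x => (k x : ℚ) :=
  ⟨k, fun _ => 0, fun _ => 0, hk, Primrec.const 0, Primrec.const 0, fun x => by simp⟩

theorem const_nat (n : ℕ) : PrimrecRat fun _ : α => (n : ℚ) := natCast (Primrec.const n)

theorem ratCode {k : α → ℕ} (hk : Primrec k) : PrimrecRat fun x => ratCode (k x) := by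
  suffices h : PrimrecRat fun n : ℕ => FormalDisint.ratCode n from h.comp hk
  have h1 := Primrec.fst.comp Primrec.unpair
  -- The parity of the code of the numerator selects which of the two parts of the difference is
  -- nonzero.
  refine ⟨fun n => (1 - n.unpair.1 % 2) * (n.unpair.1 / 2),
    fun n => (n.unpair.1 % 2) * (n.unpair.1 / 2 + 1), fun n => n.unpair.2, ?_, ?_,
    Primrec.snd.comp Primrec.unpair, fun n => ?_⟩
  · exact Primrec.nat_mul.comp
      (Primrec.nat_sub.comp (Primrec.const 1) (Primrec.nat_mod.comp h1 (Primrec.const 2)))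
      (Primrec.nat_div.comp h1 (Primrec.const 2))
  · exact Primrec.nat_mul.comp (Primrec.nat_mod.comp h1 (Primrec.const 2))
      (Primrec.succ.comp (Primrec.nat_div.comp h1 (Primrec.const 2)))
  · unfold FormalDisint.ratCode
    beta_reduce
    congr 1
    rcases Nat.even_or_odd' n.unpair.1 with ⟨m, h | h⟩
    · rw [h, ofNat_int_two_mul]
      simp
    · rw [h, ofNat_int_two_mul_add_one]
      have h3 : (2 * m + 1) % 2 = 1 := by lia
      have h4 : (2 * m + 1) / 2 = m := by lia
      rw [h3, h4]
      simp

/-- Passing back to codes lets recursions with rational values, as in `pow` and `list_sum`, run on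
natural numbers. -/
theorem exists_code (hf : PrimrecRat f) :
    ∃ c : α → ℕ, Primrec c ∧ ∀ x, FormalDisint.ratCode (c x) = f x := by
  obtain ⟨a, b, d, ha, hb, hd, h⟩ := hf
  -- The extra `1` is subtracted because the odd number `2n + 1` codes `-(n + 1)`.
  refine ⟨fun x => Nat.pair (if b x ≤ a x then 2 * (a x - b x) else 2 * (b x - a x - 1) + 1) (d x),
    ?_, fun x => ?_⟩
  · have hab := Primrec.nat_sub.comp ha hb
    have hba := Primrec.nat_sub.comp (Primrec.nat_sub.comp hb ha) (Primrec.const 1)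
    exact Primrec₂.natPair.comp (Primrec.ite (Primrec.nat_le.comp hb ha)
      (Primrec.nat_double.comp hab) (Primrec.nat_double_succ.comp hba)) hd
  · rw [h, FormalDisint.ratCode, Nat.unpair_pair]
    congr 1
    split_ifs with hle
    · rw [ofNat_int_two_mul]
      push_cast [hle]
      rfl
    · rw [ofNat_int_two_mul_add_one]
      obtain ⟨e, he⟩ := Nat.exists_eq_add_of_lt (not_le.1 hle)
      rw [he]
      have : a x + e + 1 - a x - 1 = e := by lia
      rw [this]
      push_cast
      ring

theorem posRatCode {k : α → ℕ} (hk : Primrec k) :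
    PrimrecRat fun x => FormalDisint.posRatCode (k x) :=
  ⟨fun x => (k x).unpair.1 + 1, fun _ => 0, fun x => (k x).unpair.2,
    Primrec.succ.comp (Primrec.fst.comp (Primrec.unpair.comp hk)), Primrec.const 0,
    Primrec.snd.comp (Primrec.unpair.comp hk), fun x => by simp [FormalDisint.posRatCode]⟩

/-- Denominators are stored minus one, and this number is `(d + 1)(e + 1) - 1`. -/
theorem primrec_den {d e : α → ℕ} (hd : Primrec d) (he : Primrec e) :
    Primrec fun x => d x * e x + d x + e x :=
  Primrec.nat_add.comp (Primrec.nat_add.comp (Primrec.nat_mul.comp hd he) hd) he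

theorem neg (hf : PrimrecRat f) : PrimrecRat fun x => -f x := by
  obtain ⟨a, b, d, ha, hb, hd, h⟩ := hf
  exact ⟨b, a, d, hb, ha, hd, fun x => by beta_reduce; rw [h]; ring⟩

theorem add (hf : PrimrecRat f) (hg : PrimrecRat g) : PrimrecRat fun x => f x + g x := by
  obtain ⟨a, b, d, ha, hb, hd, h⟩ := hf
  obtain ⟨a', b', d', ha', hb', hd', h'⟩ := hg
  refine ⟨fun x => a x * (d' x + 1) + a' x * (d x + 1),
    fun x => b x * (d' x + 1) + b' x * (d x + 1), _, ?_, ?_, primrec_den hd hd', fun x => ?_⟩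
  · exact Primrec.nat_add.comp (Primrec.nat_mul.comp ha (Primrec.succ.comp hd'))
      (Primrec.nat_mul.comp ha' (Primrec.succ.comp hd))
  · exact Primrec.nat_add.comp (Primrec.nat_mul.comp hb (Primrec.succ.comp hd'))
      (Primrec.nat_mul.comp hb' (Primrec.succ.comp hd))
  · have h1 : (d x : ℚ) + 1 ≠ 0 := by positivity
    have h2 : (d' x : ℚ) + 1 ≠ 0 := by positivity
    have h3 : (d x : ℚ) * d' x + d x + d' x + 1 = (d x + 1) * (d' x + 1) := by ring
    push_cast
    rw [h, h', h3]
    field_simp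
    ring

theorem sub (hf : PrimrecRat f) (hg : PrimrecRat g) : PrimrecRat fun x => f x - g x :=
  (hf.add hg.neg).of_eq fun _ => (sub_eq_add_neg _ _).symm

theorem mul (hf : PrimrecRat f) (hg : PrimrecRat g) : PrimrecRat fun x => f x * g x := by
  obtain ⟨a, b, d, ha, hb, hd, h⟩ := hf
  obtain ⟨a', b', d', ha', hb', hd', h'⟩ := hg
  refine ⟨fun x => a x * a' x + b x * b' x, fun x => a x * b' x + b x * a' x, _, ?_, ?_,
    primrec_den hd hd', fun x => ?_⟩
  · exact Primrec.nat_add.comp (Primrec.nat_mul.comp ha ha') (Primrec.nat_mul.comp hb hb')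
  · exact Primrec.nat_add.comp (Primrec.nat_mul.comp ha hb') (Primrec.nat_mul.comp hb ha')
  · have h1 : (d x : ℚ) + 1 ≠ 0 := by positivity
    have h2 : (d' x : ℚ) + 1 ≠ 0 := by positivity
    have h3 : (d x : ℚ) * d' x + d x + d' x + 1 = (d x + 1) * (d' x + 1) := by ring
    push_cast
    rw [h, h', h3]
    field_simp
    ring

theorem abs (hf : PrimrecRat f) : PrimrecRat fun x => |f x| := by
  obtain ⟨a, b, d, ha, hb, hd, h⟩ := hf
  refine ⟨fun x => (a x - b x) + (b x - a x), fun _ => 0, d, ?_, Primrec.const 0, hd, fun x => ?_⟩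
  · exact Primrec.nat_add.comp (Primrec.nat_sub.comp ha hb) (Primrec.nat_sub.comp hb ha)
  · have hd' : (0 : ℚ) < d x + 1 := by positivity
    beta_reduce
    rw [h, abs_div, abs_of_pos hd']
    congr 1
    rcases le_total (a x) (b x) with hab | hab
    · have : (a x : ℚ) ≤ b x := by exact_mod_cast hab
      rw [abs_of_nonpos (by linarith), Nat.sub_eq_zero_of_le hab]
      push_cast [hab]
      ring
    · have : (b x : ℚ) ≤ a x := by exact_mod_cast hab
      rw [abs_of_nonneg (by linarith), Nat.sub_eq_zero_of_le hab]
      push_cast [hab]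
      ring

/-- `1 / (k + 1)` -/
theorem one_div_succ {k : α → ℕ} (hk : Primrec k) : PrimrecRat fun x => 1 / ((k x : ℚ) + 1) :=
  ⟨fun _ => 1, fun _ => 0, k, Primrec.const 1, Primrec.const 0, hk, fun x => by simp⟩

theorem lt (hf : PrimrecRat f) (hg : PrimrecRat g) : PrimrecPred fun x => f x < g x := by
  obtain ⟨a, b, d, ha, hb, hd, h⟩ := hf
  obtain ⟨a', b', d', ha', hb', hd', h'⟩ := hg
  -- Cross-multiplied, with the negative parts moved to the other side, which avoids truncated
  -- subtraction.
  have key : PrimrecPred fun x => a x * (d' x + 1) + b' x * (d x + 1) <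
      a' x * (d x + 1) + b x * (d' x + 1) := by
    have h1 := Primrec.succ.comp hd
    have h2 := Primrec.succ.comp hd'
    exact Primrec.nat_lt.comp
      (Primrec.nat_add.comp (Primrec.nat_mul.comp ha h2) (Primrec.nat_mul.comp hb' h1))
      (Primrec.nat_add.comp (Primrec.nat_mul.comp ha' h1) (Primrec.nat_mul.comp hb h2))
  refine key.of_eq fun x => ?_
  rw [h, h', div_lt_div_iff₀ (by positivity) (by positivity), ← Nat.cast_lt (α := ℚ)]
  push_cast
  constructor <;> intro <;> linarith

theorem le (hf : PrimrecRat f) (hg : PrimrecRat g) : PrimrecPred fun x => f x ≤ g x :=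
  (hg.lt hf).not.of_eq fun _ => not_lt

theorem pow (hf : PrimrecRat f) {k : α → ℕ} (hk : Primrec k) : PrimrecRat fun x => f x ^ k x := by
  obtain ⟨c, hc, hcf⟩ := hf.exists_code
  obtain ⟨m, hm, hmul⟩ := ((ratCode Primrec.fst).mul (ratCode (Primrec.snd (α := ℕ)
    (β := ℕ)))).exists_code
  obtain ⟨u, _, hu⟩ := (const_nat (α := ℕ) 1).exists_code
  have hrec : Primrec fun x => Nat.rec (motive := fun _ => ℕ) (u 0) (fun _ i => m (i, c x)) (k x) :=
    Primrec.nat_rec' (h := fun x p => m (p.2, c x)) hk (Primrec.const _)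
      (hm.comp (Primrec.pair (Primrec.snd.comp Primrec.snd) (hc.comp Primrec.fst)))
  refine (ratCode hrec).of_eq fun x => ?_
  induction k x with
  | zero => simp [hu]
  | succ n ih => simp only [hmul, ih, hcf, pow_succ]

theorem list_sum {l : α → List β} (hl : Primrec l) {f : α → β → ℚ}
    (hf : PrimrecRat fun x : α × β => f x.1 x.2) :
    PrimrecRat fun x => ((l x).map (f x)).sum := by
  obtain ⟨c, hc, hcf⟩ := hf.exists_code
  obtain ⟨m, hm, hadd⟩ := ((ratCode Primrec.fst).add (ratCode (Primrec.snd (α := ℕ)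
    (β := ℕ)))).exists_code
  obtain ⟨u, _, hu⟩ := (const_nat (α := ℕ) 0).exists_code
  have hrec : Primrec fun x => (l x).foldr (fun b s => m (c (x, b), s)) (u 0) :=
    Primrec.list_foldr (h := fun x bs => m (c (x, bs.1), bs.2)) hl (Primrec.const _)
      (hm.comp (Primrec.pair (hc.comp (Primrec.pair Primrec.fst (Primrec.fst.comp Primrec.snd)))
        (Primrec.snd.comp Primrec.snd)))
  refine (ratCode hrec).of_eq fun x => ?_
  induction l x with
  | nil => simp [hu]
  | cons b t ih => simp only [List.foldr_cons, hadd, ih, hcf, List.map_cons, List.sum_cons]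

end PrimrecRat

end RationalFunctions

/-! ### Surjectivity and size of the codings of rational numbers. -/

theorem exists_ratCode_eq (q : ℚ) : ∃ n, ratCode n = q := by
  refine ⟨Nat.pair (encode q.num) (q.den - 1), ?_⟩
  have : ((q.den - 1 : ℕ) : ℚ) + 1 = q.den := by
    have := q.den_pos
    push_cast [Nat.succ_le_of_lt this]
    ring
  rw [ratCode, Nat.unpair_pair, Denumerable.ofNat_encode, this, Rat.num_div_den]

theorem exists_posRatCode_eq {q : ℚ} (hq : 0 < q) : ∃ n, posRatCode n = q := by
  refine ⟨Nat.pair (q.num.toNat - 1) (q.den - 1), ?_⟩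
  have h1 : ((q.den - 1 : ℕ) : ℚ) + 1 = q.den := by
    have := q.den_pos
    push_cast [Nat.succ_le_of_lt this]
    ring
  have h2 : ((q.num.toNat - 1 : ℕ) : ℚ) + 1 = q.num := by
    have h0 := Rat.num_pos.2 hq
    have h3 : 1 ≤ q.num.toNat := by lia
    have h4 : ((q.num.toNat : ℤ) : ℚ) = q.num := by rw [Int.toNat_of_nonneg h0.le]
    push_cast [h3] at h4 ⊢
    linarith
  rw [posRatCode, Nat.unpair_pair, h1, h2, Rat.num_div_den]

theorem posRatCode_pos (n : ℕ) : 0 < posRatCode n := by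
  unfold posRatCode
  positivity

theorem ratCode_zero : ratCode 0 = 0 := by
  have := ofNat_int_two_mul 0
  simp_all [ratCode]

theorem abs_ratCode_le (n : ℕ) : |ratCode n| ≤ n := by
  have h1 : |((Denumerable.ofNat ℤ n.unpair.1 : ℤ) : ℚ)| ≤ n.unpair.1 := by
    rcases Nat.even_or_odd' n.unpair.1 with ⟨m, h | h⟩
    · rw [h, ofNat_int_two_mul]
      push_cast
      rw [abs_of_nonneg (by positivity)]
      linarith [Nat.cast_nonneg (α := ℚ) m]
    · rw [h, ofNat_int_two_mul_add_one]
      push_cast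
      rw [abs_neg, abs_of_nonneg (by positivity)]
      linarith [Nat.cast_nonneg (α := ℚ) m]
  have h2 : (n.unpair.1 : ℚ) ≤ n := by exact_mod_cast Nat.unpair_left_le n
  have h3 : (0 : ℚ) < n.unpair.2 + 1 := by positivity
  rw [ratCode, abs_div, abs_of_pos h3, div_le_iff₀ h3]
  nlinarith [Nat.cast_nonneg (α := ℚ) n.unpair.2, Nat.cast_nonneg (α := ℚ) n]

/-! ### Arithmetic of rational scalars -/

section Scalar

variable (𝕜 : Type*) [RCLike 𝕜]

theorem scalarCode_pair (a b : ℕ) :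
    scalarCode 𝕜 (Nat.pair a b) = ((ratCode a : ℚ) : 𝕜) + ((ratCode b : ℚ) : 𝕜) * RCLike.I := by
  simp [scalarCode]

theorem scalarCode_zero : scalarCode 𝕜 0 = 0 := by
  simp [scalarCode, ratCode_zero]

theorem exists_scalarCode_eq_ratCast (q : ℚ) : ∃ n, scalarCode 𝕜 n = (q : 𝕜) := by
  obtain ⟨a, ha⟩ := exists_ratCode_eq q
  exact ⟨Nat.pair a 0, by simp [scalarCode_pair, ha, ratCode_zero]⟩

/-- A crude bound that depends on the code alone and therefore makes the error bound `combErr`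
primitive recursive. The real and the imaginary part contribute at most `n` each. -/
theorem norm_scalarCode_le (n : ℕ) : ‖scalarCode 𝕜 n‖ ≤ 2 * n := by
  have key : ∀ m, m ≤ n → ‖((ratCode m : ℚ) : 𝕜)‖ ≤ n := fun m hm => by
    rw [← RCLike.ofReal_ratCast, RCLike.norm_ofReal]
    have h1 : (|ratCode m| : ℚ) ≤ n := (abs_ratCode_le m).trans (by exact_mod_cast hm)
    exact_mod_cast h1
  calc ‖scalarCode 𝕜 n‖
      ≤ ‖((ratCode n.unpair.1 : ℚ) : 𝕜)‖ + ‖((ratCode n.unpair.2 : ℚ) : 𝕜)‖ * ‖(RCLike.I : 𝕜)‖ :=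
        (norm_add_le _ _).trans (by rw [norm_mul])
    _ ≤ n + n * 1 := by
        have h1 : ‖(RCLike.I : 𝕜)‖ ≤ 1 := by
          rw [RCLike.norm_I]
          split_ifs <;> norm_num
        gcongr
        · exact key _ (Nat.unpair_left_le n)
        · exact key _ (Nat.unpair_right_le n)
    _ = 2 * n := by ring

theorem exists_scalarAdd : ∃ s : ℕ → ℕ → ℕ, Primrec₂ s ∧
    ∀ a b, scalarCode 𝕜 (s a b) = scalarCode 𝕜 a + scalarCode 𝕜 b := by
  obtain ⟨m, hm, hadd⟩ := ((PrimrecRat.ratCode Primrec.fst).add (PrimrecRat.ratCode (Primrec.snd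
    (α := ℕ) (β := ℕ)))).exists_code
  have h1 : Primrec fun p : ℕ × ℕ => p.1.unpair := Primrec.unpair.comp Primrec.fst
  have h2 : Primrec fun p : ℕ × ℕ => p.2.unpair := Primrec.unpair.comp Primrec.snd
  refine ⟨fun a b => Nat.pair (m (a.unpair.1, b.unpair.1)) (m (a.unpair.2, b.unpair.2)),
    Primrec₂.natPair.comp (hm.comp (Primrec.pair (Primrec.fst.comp h1) (Primrec.fst.comp h2)))
      (hm.comp (Primrec.pair (Primrec.snd.comp h1) (Primrec.snd.comp h2))), fun a b => ?_⟩
  rw [scalarCode_pair, hadd, hadd, scalarCode, scalarCode]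
  push_cast
  ring

theorem exists_scalarMul : ∃ s : ℕ → ℕ → ℕ, Primrec₂ s ∧
    ∀ a b, scalarCode 𝕜 (s a b) = scalarCode 𝕜 a * scalarCode 𝕜 b := by
  have h1 : Primrec fun p : ℕ × ℕ => p.1.unpair := Primrec.unpair.comp Primrec.fst
  have h2 : Primrec fun p : ℕ × ℕ => p.2.unpair := Primrec.unpair.comp Primrec.snd
  have x1 := PrimrecRat.ratCode (Primrec.fst.comp h1)
  have y1 := PrimrecRat.ratCode (Primrec.snd.comp h1)
  have x2 := PrimrecRat.ratCode (Primrec.fst.comp h2)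
  have y2 := PrimrecRat.ratCode (Primrec.snd.comp h2)
  -- In the real case `I` vanishes and the second components are irrelevant; otherwise `I * I = -1`.
  by_cases hI : (RCLike.I : 𝕜) = 0
  · obtain ⟨c, hc, h⟩ := (x1.mul x2).exists_code
    refine ⟨fun a b => Nat.pair (c (a, b)) 0, Primrec₂.natPair.comp hc (Primrec.const 0),
      fun a b => ?_⟩
    simp [h, scalarCode, hI]
  · have hII := RCLike.I_mul_I_of_nonzero hI
    obtain ⟨c, hc, h⟩ := ((x1.mul x2).sub (y1.mul y2)).exists_code
    obtain ⟨d, hd, h'⟩ := ((x1.mul y2).add (y1.mul x2)).exists_code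
    refine ⟨fun a b => Nat.pair (c (a, b)) (d (a, b)), Primrec₂.natPair.comp hc hd, fun a b => ?_⟩
    rw [scalarCode_pair, h, h', scalarCode, scalarCode]
    push_cast
    linear_combination (-((ratCode a.unpair.2 : ℚ) : 𝕜) * ((ratCode b.unpair.2 : ℚ) : 𝕜)) * hII

theorem denseRange_scalarCode : DenseRange (scalarCode 𝕜) := by
  have h1 : DenseRange fun n => ((ratCode n : ℚ) : ℝ) :=
    (Rat.denseRange_cast (𝕜 := ℝ)).comp
      (Function.Surjective.denseRange exists_ratCode_eq) Rat.continuous_coe_real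
  have h2 := h1.prodMap h1
  have hc : Continuous fun z : ℝ × ℝ => (z.1 : 𝕜) + (z.2 : 𝕜) * RCLike.I := by fun_prop
  have hs : Function.Surjective fun z : ℝ × ℝ => (z.1 : 𝕜) + (z.2 : 𝕜) * RCLike.I :=
    fun z => ⟨(RCLike.re z, RCLike.im z), RCLike.re_add_im z⟩
  refine (hs.denseRange.comp h2 hc).mono ?_
  rintro _ ⟨⟨a, b⟩, rfl⟩
  exact ⟨Nat.pair a b, by simp [scalarCode_pair]⟩

end Scalar

/-! ### Arithmetic of rational vectors -/

section Vector

variable (𝕜 : Type*) [RCLike 𝕜]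

/-- The code `0` stands for the scalar `0`, so coefficient lists may be padded and lists of
different lengths added entrywise. -/
theorem ratVec_eq_sum {B : Type*} [NormedAddCommGroup B] [NormedSpace 𝕜 B] (R : ℕ → B) (n : ℕ)
    {N : ℕ} (hN : (Denumerable.ofNat (List ℕ) n).length ≤ N) :
    ratVec 𝕜 R n = ∑ j ∈ Finset.range N,
      scalarCode 𝕜 ((Denumerable.ofNat (List ℕ) n).getD j 0) • R j := by
  set l := Denumerable.ofNat (List ℕ) n with hl
  have h1 : ratVec 𝕜 R n = ∑ j : Fin l.length, scalarCode 𝕜 (l.getD j 0) • R j := by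
    unfold ratVec
    rw [← hl]
    refine Finset.sum_congr rfl fun j _ => ?_
    simp
  rw [h1, Fin.sum_univ_eq_sum_range (fun j => scalarCode 𝕜 (l.getD j 0) • R j)]
  refine Finset.sum_subset (Finset.range_mono hN) fun j _ hj => ?_
  rw [List.getD_eq_default _ _ (by simpa using hj), scalarCode_zero, zero_smul]

/-- The code of a sum depends only on the coefficients, so it is chosen before the space and the
presentation; this uniformity is needed for a single predicate. -/
theorem exists_vecAdd : ∃ s : ℕ → ℕ → ℕ, Primrec₂ s ∧
    ∀ {B : Type*} [NormedAddCommGroup B] [NormedSpace 𝕜 B] (R : ℕ → B) (a b : ℕ),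
      ratVec 𝕜 R (s a b) = ratVec 𝕜 R a + ratVec 𝕜 R b := by
  obtain ⟨s, hs, hadd⟩ := exists_scalarAdd 𝕜
  have hl : Primrec (Denumerable.ofNat (List ℕ)) := Primrec.ofNat _
  have h1 : Primrec fun p : ℕ × ℕ => Denumerable.ofNat (List ℕ) p.1 := hl.comp Primrec.fst
  have h2 : Primrec fun p : ℕ × ℕ => Denumerable.ofNat (List ℕ) p.2 := hl.comp Primrec.snd
  refine ⟨fun a b => encode ((List.range (max (Denumerable.ofNat (List ℕ) a).length
    (Denumerable.ofNat (List ℕ) b).length)).map fun j =>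
      s ((Denumerable.ofNat (List ℕ) a).getD j 0) ((Denumerable.ofNat (List ℕ) b).getD j 0)),
    ?_, fun R a b => ?_⟩
  · exact Primrec.encode.comp (Primrec.list_map (Primrec.list_range.comp
      (Primrec.nat_max.comp (Primrec.list_length.comp h1) (Primrec.list_length.comp h2)))
      (hs.comp ((Primrec.list_getD 0).comp (h1.comp Primrec.fst) Primrec.snd)
        ((Primrec.list_getD 0).comp (h2.comp Primrec.fst) Primrec.snd)))
  · rw [ratVec_eq_sum 𝕜 R a (le_max_left _ (Denumerable.ofNat (List ℕ) b).length),
      ratVec_eq_sum 𝕜 R b (le_max_right (Denumerable.ofNat (List ℕ) a).length _),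
      ← Finset.sum_add_distrib, ratVec_eq_sum 𝕜 R _ (by
        rw [Denumerable.ofNat_encode, List.length_map, List.length_range])]
    refine Finset.sum_congr rfl fun j hj => ?_
    rw [Denumerable.ofNat_encode, ← add_smul, ← hadd, List.getD_eq_getElem _ _
      (by simpa using hj), List.getElem_map, List.getElem_range]

theorem exists_vecSMul : ∃ s : ℕ → ℕ → ℕ, Primrec₂ s ∧
    ∀ {B : Type*} [NormedAddCommGroup B] [NormedSpace 𝕜 B] (R : ℕ → B) (a b : ℕ),
      ratVec 𝕜 R (s a b) = scalarCode 𝕜 a • ratVec 𝕜 R b := by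
  obtain ⟨s, hs, hmul⟩ := exists_scalarMul 𝕜
  have hl : Primrec (Denumerable.ofNat (List ℕ)) := Primrec.ofNat _
  refine ⟨fun a b => encode ((Denumerable.ofNat (List ℕ) b).map (s a)), ?_, fun R a b => ?_⟩
  · exact Primrec.encode.comp (Primrec.list_map (hl.comp Primrec.snd)
      (hs.comp (Primrec.fst.comp Primrec.fst) Primrec.snd))
  · rw [ratVec_eq_sum 𝕜 R b le_rfl, Finset.smul_sum, ratVec_eq_sum 𝕜 R _ (by
      rw [Denumerable.ofNat_encode, List.length_map])]
    refine Finset.sum_congr rfl fun j hj => ?_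
    have hj : j < (Denumerable.ofNat (List ℕ) b).length := by simpa using hj
    rw [Denumerable.ofNat_encode, smul_smul, ← hmul, List.getD_eq_getElem _ _ (by simpa using hj),
      List.getElem_map, List.getD_eq_getElem _ _ hj]

variable {𝕜} {B : Type*} [NormedAddCommGroup B] [NormedSpace 𝕜 B]

theorem ratVec_encode_nil (R : ℕ → B) : ratVec 𝕜 R (encode ([] : List ℕ)) = 0 := by
  rw [ratVec_eq_sum 𝕜 R _ (N := 0) (by simp)]
  simp

theorem exists_ratVec_eq (R : ℕ → B) (j : ℕ) : ∃ n, ratVec 𝕜 R n = R j := by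
  obtain ⟨u, hu⟩ := exists_scalarCode_eq_ratCast 𝕜 1
  refine ⟨encode (List.replicate j 0 ++ [u]), ?_⟩
  rw [ratVec_eq_sum 𝕜 R _ (N := j + 1) (by simp), Denumerable.ofNat_encode,
    Finset.sum_range_succ, Finset.sum_eq_zero]
  · simp [hu]
  · intro i hi
    have hi : i < j := by simpa using hi
    rw [List.getD_append _ _ _ _ (by simpa using hi)]
    simp [hi, scalarCode_zero]

/-- A set closed under sums and rational multiples has the span of `s` in its closure if it
contains `s`. -/
theorem span_subset_closure {s A : Set B} (h0 : (0 : B) ∈ A) (hs : s ⊆ A)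
    (hadd : ∀ x ∈ A, ∀ y ∈ A, x + y ∈ A) (hsmul : ∀ n, ∀ x ∈ A, scalarCode 𝕜 n • x ∈ A) :
    (Submodule.span 𝕜 s : Set B) ⊆ closure A := by
  intro x hx
  induction hx using Submodule.span_induction with
  | mem x h => exact subset_closure (hs h)
  | zero => exact subset_closure h0
  | add x y _ _ hx hy => exact map_mem_closure₂ continuous_add hx hy hadd
  | smul a x _ hx =>
    refine map_mem_closure₂ (s := Set.range (scalarCode 𝕜)) continuous_smul
      (denseRange_scalarCode 𝕜 a) hx ?_
    rintro _ ⟨n, rfl⟩ y hy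
    exact hsmul n y hy

theorem denseRange_ratVec {R : ℕ → B} (hR : IsPresentation 𝕜 R) : DenseRange (ratVec 𝕜 R) := by
  obtain ⟨s, _, hs⟩ := exists_vecAdd 𝕜
  obtain ⟨t, _, ht⟩ := exists_vecSMul 𝕜
  intro x
  have := span_subset_closure (𝕜 := 𝕜) (s := Set.range R) (A := Set.range (ratVec 𝕜 R))
    ⟨_, ratVec_encode_nil R⟩ (by rintro _ ⟨j, rfl⟩; exact exists_ratVec_eq R j)
    (by rintro _ ⟨a, rfl⟩ _ ⟨b, rfl⟩; exact ⟨_, hs R a b⟩)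
    (by rintro n _ ⟨a, rfl⟩; exact ⟨_, ht R n a⟩)
  exact closure_minimal this isClosed_closure (hR x)

end Vector

/-! ### Primitive recursive auxiliary functions -/

attribute [fun_prop] Primrec Primrec.id Primrec.const Primrec.comp Primrec.fst Primrec.snd
  Primrec.encode Primrec.pair

section Primrec

variable {α β γ : Type*} [Primcodable α] [Primcodable β] [Primcodable γ]

@[fun_prop]
theorem primrec_natPair {f g : α → ℕ} (hf : Primrec f) (hg : Primrec g) :
    Primrec fun x => Nat.pair (f x) (g x) := Primrec₂.natPair.comp hf hg

@[fun_prop]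
theorem primrec_unpair {f : α → ℕ} (hf : Primrec f) : Primrec fun x => (f x).unpair :=
  Primrec.unpair.comp hf

@[fun_prop]
theorem primrec_add {f g : α → ℕ} (hf : Primrec f) (hg : Primrec g) :
    Primrec fun x => f x + g x := Primrec.nat_add.comp hf hg

@[fun_prop]
theorem primrec_two_pow {f : α → ℕ} (hf : Primrec f) : Primrec fun x => 2 ^ f x :=
  (Primrec₂.unpaired'.1 Nat.Primrec.pow).comp (Primrec.const 2) hf

@[fun_prop]
theorem primrec_cons {f : α → β} {g : α → List β} (hf : Primrec f) (hg : Primrec g) :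
    Primrec fun x => f x :: g x := Primrec.list_cons.comp hf hg

@[fun_prop]
theorem primrec_append {f g : α → List β} (hf : Primrec f) (hg : Primrec g) :
    Primrec fun x => f x ++ g x := Primrec.list_append.comp hf hg

theorem primrec_map {f : α → List β} {g : α → β → γ} (hf : Primrec f)
    (hg : Primrec fun x : α × β => g x.1 x.2) : Primrec fun x => (f x).map (g x) :=
  Primrec.list_map hf hg

theorem primrecPred_eq {f g : α → β} (hf : Primrec f) (hg : Primrec g) :
    PrimrecPred fun x => f x = g x := Primrec.eq.comp hf hg

theorem primrecPred_testBit : PrimrecPred fun q : ℕ × ℕ => q.1.testBit q.2 = true :=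
  (primrecPred_eq (Primrec.nat_mod.comp (Primrec.nat_div.comp Primrec.fst
    (primrec_two_pow Primrec.snd)) (Primrec.const 2)) (Primrec.const 1)).of_eq
    fun q => by simp [Nat.testBit_eq_decide_div_mod_eq]

theorem primrecRel_prefix : PrimrecRel fun μ ν : List β => μ <+: ν :=
  (primrecPred_eq Primrec.fst (Primrec.list_take.comp (Primrec.list_length.comp Primrec.fst)
    Primrec.snd)).of_eq fun _ => List.prefix_iff_eq_take.symm

theorem primrecPred_pairwise {r : β → β → Prop} (hr : PrimrecRel r) :
    PrimrecPred fun l : List β => l.Pairwise r := by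
  classical
  have hrec : Primrec fun l : List β => @List.rec β (fun _ => Bool) true
      (fun b t ih => decide (∀ c ∈ t, r b c) && ih) l := by
    have h1 : PrimrecRel fun (t : List β) (b : β) => ∀ c ∈ t, r b c :=
      PrimrecRel.forall_mem_list (R := fun c b => r b c) (hr.comp Primrec.snd Primrec.fst)
    have h2 : PrimrecPred fun q : List β × β × List β × Bool => ∀ c ∈ q.2.2.1, r q.2.1 c :=
      h1.comp (f := fun q : List β × β × List β × Bool => q.2.2.1) (g := fun q => q.2.1)
        (by fun_prop) (by fun_prop)
    exact Primrec.list_rec (h := fun _ q => decide (∀ c ∈ q.2.1, r q.1 c) && q.2.2) Primrec.id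
      (Primrec.const true) (Primrec.and.comp h2.decide
        (Primrec.snd.comp (Primrec.snd.comp Primrec.snd)))
  refine (primrecPred_eq hrec (Primrec.const true)).of_eq fun l => ?_
  induction l with
  | nil => simp
  | cons b t ih => simp [← ih]

end Primrec

/-! ### Coded vector arithmetic -/

/-- Primitive recursive arithmetic on the codes of rational vectors. -/
structure VectorArithmetic.{v, u} (𝕜 : Type u) [RCLike 𝕜] where
  add : ℕ → ℕ → ℕ
  smul : ℕ → ℕ → ℕ
  one : ℕ
  negOne : ℕ
  primrec_add : Primrec₂ add
  primrec_smul : Primrec₂ smul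
  scalarCode_one : scalarCode 𝕜 one = 1
  scalarCode_negOne : scalarCode 𝕜 negOne = -1
  ratVec_add : ∀ {B : Type v} [NormedAddCommGroup B] [NormedSpace 𝕜 B] (R : ℕ → B) (a b : ℕ),
    ratVec 𝕜 R (add a b) = ratVec 𝕜 R a + ratVec 𝕜 R b
  ratVec_smul : ∀ {B : Type v} [NormedAddCommGroup B] [NormedSpace 𝕜 B] (R : ℕ → B) (a b : ℕ),
    ratVec 𝕜 R (smul a b) = scalarCode 𝕜 a • ratVec 𝕜 R b

theorem nonempty_vectorArithmetic.{v, u} (𝕜 : Type u) [RCLike 𝕜] :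
    Nonempty (VectorArithmetic.{v} 𝕜) := by
  obtain ⟨add, hadd, h1⟩ := exists_vecAdd.{u, v} 𝕜
  obtain ⟨smul, hsmul, h2⟩ := exists_vecSMul.{u, v} 𝕜
  obtain ⟨one, h3⟩ := exists_scalarCode_eq_ratCast 𝕜 1
  obtain ⟨negOne, h4⟩ := exists_scalarCode_eq_ratCast 𝕜 (-1)
  exact ⟨⟨add, smul, one, negOne, hadd, hsmul, by simpa using h3, by simpa using h4, h1, h2⟩⟩

namespace VectorArithmetic

variable {𝕜 : Type*} [RCLike 𝕜] (C : VectorArithmetic 𝕜)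

/-- The code of a difference of rational vectors. -/
def sub (a b : ℕ) : ℕ := C.add a (C.smul C.negOne b)

/-- The code of `∑ α_i c_i + c` for a list of triples of a node, a scalar `α_i` and a ball with
center `c_i`. -/
def combCode (T : List (List ℕ × ℕ × ℕ)) (c : ℕ) : ℕ :=
  T.foldr (fun t v => C.add (C.smul t.2.1 t.2.2.unpair.1) v) c

@[fun_prop]
theorem primrec_sub' {α : Type*} [Primcodable α] {f g : α → ℕ} (hf : Primrec f)
    (hg : Primrec g) : Primrec fun x => C.sub (f x) (g x) :=
  C.primrec_add.comp hf (C.primrec_smul.comp (Primrec.const _) hg)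

@[fun_prop]
theorem primrec_combCode {α : Type*} [Primcodable α] {f : α → List (List ℕ × ℕ × ℕ)} {g : α → ℕ}
    (hf : Primrec f) (hg : Primrec g) : Primrec fun x => C.combCode (f x) (g x) :=
  have h1 : Primrec fun q : α × (List ℕ × ℕ × ℕ) × ℕ => q.2.1.2.1 := by fun_prop
  have h2 : Primrec fun q : α × (List ℕ × ℕ × ℕ) × ℕ => q.2.1.2.2.unpair.1 := by fun_prop
  have h3 : Primrec fun q : α × (List ℕ × ℕ × ℕ) × ℕ =>
      C.add (C.smul q.2.1.2.1 q.2.1.2.2.unpair.1) q.2.2 :=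
    C.primrec_add.comp (C.primrec_smul.comp h1 h2) (Primrec.snd.comp Primrec.snd)
  Primrec.list_foldr hf hg h3.to₂

end VectorArithmetic

/-- A bound for the error made in `∑ α_i v_i` when every `v_i` is replaced by the center of a ball
that contains it. -/
def combErr (T : List (List ℕ × ℕ × ℕ)) : ℚ :=
  (T.map fun t => 2 * (t.2.1 : ℚ) * posRatCode t.2.2.unpair.2).sum

/-! ### The conditions on the names -/

section Conditions

variable {𝕜 : Type*} [RCLike 𝕜] (C : VectorArithmetic 𝕜) (F : Fin 3 → ℕ → ℕ)

/-- `i` is listed by the name of the presentation. -/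
def InDiagram (i : ℕ) : Prop := ∃ s, F 0 s = i

/-- `(ν, n)` belongs to one of the finite sets listed by the name of the vector tree. -/
def InGraph (ν : List ℕ) (n : ℕ) : Prop := ∃ s, (F 1 s).testBit (Nat.pair (encode ν) n) = true

/-- `ν` is a node of the named vector tree. -/
def OnTree (ν : List ℕ) : Prop := ∃ n, InGraph F ν n

/-- The norm of the `m`-th rational vector is less than `q`. -/
def NormLt (m : ℕ) (q : ℚ) : Prop :=
  ∃ i, InDiagram F (Nat.pair m i) ∧ ratCode i.unpair.1 + posRatCode i.unpair.2 ≤ q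

/-- The norm of the sum of the `c`-th rational vector and the combination `L` of vectors of the tree
differs from `x` by less than `r`. -/
def CombNorm (c : ℕ) (L : List (List ℕ × ℕ)) (x r : ℚ) : Prop :=
  ∃ (T : List (List ℕ × ℕ × ℕ)) (j : ℕ), T.map (fun t => (t.1, t.2.1)) = L ∧
    (∀ t ∈ T, InGraph F t.1 t.2.2) ∧ InDiagram F (Nat.pair (C.combCode T c) j) ∧
    |ratCode j.unpair.1 - x| + posRatCode j.unpair.2 + combErr T < r

/-- The range of the name of the tree contains the code of the empty set and is closed under the
addition of a larger element. -/
def EnumerationCond : Prop :=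
  (∃ s, F 1 s = 0) ∧ ∀ q : ℕ × List ℕ × ℕ,
    ((∃ s, F 1 s = q.1) ∧ q.1 < 2 ^ Nat.pair (encode q.2.1) q.2.2 ∧ InGraph F q.2.1 q.2.2) →
      ∃ s, F 1 s = q.1 + 2 ^ Nat.pair (encode q.2.1) q.2.2

/-- The nodes form a tree. -/
def TreeCond : Prop := ∀ q : List ℕ × ℕ, OnTree F (q.1 ++ [q.2]) → OnTree F q.1

/-- The balls listed for a node are arbitrarily small. -/
def SmallCond : Prop := ∀ q : List ℕ × ℕ, OnTree F q.1 →
  ∃ n, InGraph F q.1 n ∧ posRatCode n.unpair.2 < 1 / ((q.2 : ℚ) + 1)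

/-- The balls listed for a node are compatible. -/
def CompatCond : Prop := ∀ q : List ℕ × ℕ × ℕ, (InGraph F q.1 q.2.1 ∧ InGraph F q.1 q.2.2) →
  NormLt F (C.sub q.2.1.unpair.1 q.2.2.unpair.1)
    (posRatCode q.2.1.unpair.2 + posRatCode q.2.2.unpair.2)

/-- Every ball listed for a node formally contains another one. -/
def RoundCond : Prop := ∀ q : List ℕ × ℕ, InGraph F q.1 q.2 → ∃ m, InGraph F q.1 m ∧
  NormLt F (C.sub q.2.unpair.1 m.unpair.1) (posRatCode q.2.unpair.2 - posRatCode m.unpair.2)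

/-- The set of the balls listed for a node is upward closed. -/
def UpwardCond : Prop := ∀ q : List ℕ × ℕ × ℕ, (InGraph F q.1 q.2.1 ∧
  NormLt F (C.sub q.2.1.unpair.1 q.2.2.unpair.1)
    (posRatCode q.2.2.unpair.2 - posRatCode q.2.1.unpair.2)) → InGraph F q.1 q.2.2

/-- Pairwise incomparability of the nodes of a combination. -/
def Incomparable (L : List (List ℕ × ℕ)) : Prop :=
  L.Pairwise fun e e' => ¬ e.1 <+: e'.1 ∧ ¬ e'.1 <+: e.1

/-- Approximate form of the `L^p`-formal disjointness of the combination `L`; the powers with the real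
exponent `p` are replaced by powers of numbers `s ^ (b + 1)` with the exponents `a / (b + 1)`. -/
def PowerApprox (L : List (List ℕ × ℕ)) (k : ℕ) : Prop :=
  -- The components are the oracle value coding the `k`-th approximation of `p`, the numbers `a` and
  -- `b` of the exponent `a / (b + 1)`, the code of the root `s` for the whole combination, and the
  -- terms with the codes of their roots.
  ∃ w : ℕ × ℕ × ℕ × ℕ × List ((List ℕ × ℕ) × ℕ),
    F 2 k = w.1 ∧ |ratCode w.1 - w.2.1 * (1 / ((w.2.2.1 : ℚ) + 1))| < 1 / ((k : ℚ) + 1) ∧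
    w.2.2.2.2.map Prod.fst = L ∧
    CombNorm C F (encode ([] : List ℕ)) L (posRatCode w.2.2.2.1 ^ (w.2.2.1 + 1))
      (1 / ((k : ℚ) + 1)) ∧
    (∀ t ∈ w.2.2.2.2, CombNorm C F (encode ([] : List ℕ)) [t.1] (posRatCode t.2 ^ (w.2.2.1 + 1))
      (1 / ((k : ℚ) + 1))) ∧
    |posRatCode w.2.2.2.1 ^ w.2.1 - (w.2.2.2.2.map fun t => posRatCode t.2 ^ w.2.1).sum| <
      1 / ((k : ℚ) + 1)

/-- The tree is `L^p`-formally separating. -/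
def SeparatingCond : Prop := ∀ q : List (List ℕ × ℕ) × ℕ,
  ((∀ e ∈ q.1, OnTree F e.1) ∧ Incomparable q.1) → PowerApprox C F q.1 q.2

/-- The combination `∑_{a ∈ E} φ(ν a) - φ(ν)`. -/
def childrenComb (ν : List ℕ) (E : List ℕ) : List (List ℕ × ℕ) :=
  (ν, C.negOne) :: E.map fun a => (ν ++ [a], C.one)

/-- The vector at a node is approximated by sums over large finite sets of children. -/
def SummativeCond : Prop := ∀ q : List ℕ × List ℕ × ℕ,
  ((∃ a, OnTree F (q.1 ++ [a])) ∧ ∀ a ∈ q.2.1, OnTree F (q.1 ++ [a])) →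
    ∃ E : List ℕ, E.Nodup ∧ (∀ a ∈ q.2.1, a ∈ E) ∧
      CombNorm C F (encode ([] : List ℕ)) (childrenComb C q.1 E) 0 (1 / ((q.2.2 : ℚ) + 1))

/-- The vectors of the tree are nonzero. -/
def NonzeroCond : Prop := ∀ ν : List ℕ, OnTree F ν →
  ∃ i, CombNorm C F (encode ([] : List ℕ)) [(ν, C.one)] (posRatCode i) (posRatCode i)

/-- The tree is injective. -/
def InjectiveCond : Prop := ∀ q : List ℕ × List ℕ, (OnTree F q.1 ∧ OnTree F q.2 ∧ q.1 ≠ q.2) →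
  ∃ i, CombNorm C F (encode ([] : List ℕ)) [(q.1, C.one), (q.2, C.negOne)] (posRatCode i)
    (posRatCode i)

/-- The vectors of the tree are linearly dense. -/
def DenseCond : Prop := ∀ q : ℕ × ℕ, True → ∃ L, CombNorm C F q.1 L 0 (1 / ((q.2 : ℚ) + 1))

/-- The conditions under which `F 1` names a vector tree. -/
def TreeNameCond : Prop := EnumerationCond F ∧ TreeCond F ∧ SmallCond F ∧ CompatCond C F ∧
  RoundCond C F ∧ UpwardCond C F

/-- The conditions under which `F 1` names a formal disintegration. -/
def DisintegrationCond : Prop := SeparatingCond C F ∧ SummativeCond C F ∧ NonzeroCond C F ∧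
  InjectiveCond C F ∧ DenseCond C F

end Conditions

/-! ### The conditions are `Π⁰₂` -/

section Complexity

variable {α : Type*} [Primcodable α]

theorem isSigma_range (i : Fin 3) : IsSigma fun F (n : ℕ) => ∃ s, F i s = n := by
  have h : IsSigma fun F (q : ℕ × ℕ) => F i q.2 = q.1 := (IsSigma.oracle i).comp (f := fun q : ℕ × ℕ => (q.2, q.1)) (by fun_prop)
  exact h.exists'

theorem isSigma_inDiagram : IsSigma InDiagram := isSigma_range 0

theorem isSigma_inGraph : IsSigma fun F (q : List ℕ × ℕ) => InGraph F q.1 q.2 := by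
  have h1 : IsSigma fun F (q : (List ℕ × ℕ) × ℕ) => ∃ s, F 1 s = q.2 :=
    (isSigma_range 1).comp Primrec.snd
  have h2 : IsSigma fun _ (q : (List ℕ × ℕ) × ℕ) =>
      q.2.testBit (Nat.pair (encode q.1.1) q.1.2) = true :=
    IsSigma.of_primrec (primrecPred_testBit.comp
      (f := fun q : (List ℕ × ℕ) × ℕ => (q.2, Nat.pair (encode q.1.1) q.1.2)) (by fun_prop))
  refine (h1.and h2).exists'.of_eq fun F q => ?_
  constructor
  · rintro ⟨_, ⟨s, rfl⟩, h⟩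
    exact ⟨s, h⟩
  · rintro ⟨s, h⟩
    exact ⟨_, ⟨s, rfl⟩, h⟩

theorem isSigma_onTree : IsSigma OnTree := isSigma_inGraph.exists'

theorem isSigma_normLt {m : α → ℕ} {q : α → ℚ} (hm : Primrec m) (hq : PrimrecRat q) :
    IsSigma fun F x => NormLt F (m x) (q x) := by
  have h1 : IsSigma fun F (y : α × ℕ) => InDiagram F (Nat.pair (m y.1) y.2) :=
    isSigma_inDiagram.comp (by fun_prop)
  have h2 : PrimrecPred fun y : α × ℕ =>
      ratCode y.2.unpair.1 + posRatCode y.2.unpair.2 ≤ q y.1 :=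
    ((PrimrecRat.ratCode (by fun_prop)).add (PrimrecRat.posRatCode (by fun_prop))).le
      (hq.comp Primrec.fst)
  exact (h1.and (IsSigma.of_primrec h2)).exists'

theorem primrecRat_combErr : PrimrecRat combErr := by
  have h : PrimrecRat fun x : List (List ℕ × ℕ × ℕ) × (List ℕ × ℕ × ℕ) =>
      2 * (x.2.2.1 : ℚ) * posRatCode x.2.2.2.unpair.2 :=
    ((PrimrecRat.const_nat 2).mul (PrimrecRat.natCast (by fun_prop))).mul
      (PrimrecRat.posRatCode (by fun_prop))
  exact PrimrecRat.list_sum Primrec.id h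

variable {𝕜 : Type*} [RCLike 𝕜] (C : VectorArithmetic 𝕜)

theorem isSigma_combNorm {c : α → ℕ} {L : α → List (List ℕ × ℕ)} {x r : α → ℚ} (hc : Primrec c)
    (hL : Primrec L) (hx : PrimrecRat x) (hr : PrimrecRat r) :
    IsSigma fun F a => CombNorm C F (c a) (L a) (x a) (r a) := by
  have h1 : IsSigma fun _ (y : (α × List (List ℕ × ℕ × ℕ)) × ℕ) =>
      y.1.2.map (fun t => (t.1, t.2.1)) = L y.1.1 :=
    IsSigma.of_primrec (primrecPred_eq (primrec_map (by fun_prop) (by fun_prop)) (by fun_prop))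
  have h2 : IsSigma fun F (y : (α × List (List ℕ × ℕ × ℕ)) × ℕ) =>
      ∀ t ∈ y.1.2, InGraph F t.1 t.2.2 := by
    have : IsSigma fun F (z : ((α × List (List ℕ × ℕ × ℕ)) × ℕ) × (List ℕ × ℕ × ℕ)) =>
        InGraph F z.2.1 z.2.2.2 := isSigma_inGraph.comp (f := fun z : ((α × List (List ℕ × ℕ × ℕ)) × ℕ) ×
          (List ℕ × ℕ × ℕ) => (z.2.1, z.2.2.2)) (by fun_prop)
    exact this.forall_mem (by fun_prop)
  have h3 : IsSigma fun F (y : (α × List (List ℕ × ℕ × ℕ)) × ℕ) =>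
      InDiagram F (Nat.pair (C.combCode y.1.2 (c y.1.1)) y.2) :=
    isSigma_inDiagram.comp (by fun_prop)
  have h4 : PrimrecPred fun y : (α × List (List ℕ × ℕ × ℕ)) × ℕ =>
      |ratCode y.2.unpair.1 - x y.1.1| + posRatCode y.2.unpair.2 + combErr y.1.2 < r y.1.1 :=
    (((((PrimrecRat.ratCode (by fun_prop)).sub (hx.comp (by fun_prop))).abs).add
      (PrimrecRat.posRatCode (by fun_prop))).add (primrecRat_combErr.comp (by fun_prop))).lt
      (hr.comp (by fun_prop))
  exact (h1.and (h2.and (h3.and (IsSigma.of_primrec h4)))).exists'.exists'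

theorem isPi_enumerationCond : IsPi EnumerationCond := by
  have h0 : IsSigma fun F (_ : ℕ) => ∃ s, F 1 s = 0 :=
    (isSigma_range 1).comp (f := fun _ => 0) (by fun_prop)
  have h1 : IsSigma fun F (q : ℕ × List ℕ × ℕ) => ∃ s, F 1 s = q.1 :=
    (isSigma_range 1).comp Primrec.fst
  have h2 : PrimrecPred fun q : ℕ × List ℕ × ℕ => q.1 < 2 ^ Nat.pair (encode q.2.1) q.2.2 :=
    Primrec.nat_lt.comp (by fun_prop) (by fun_prop)
  have h3 : IsSigma fun F (q : ℕ × List ℕ × ℕ) => InGraph F q.2.1 q.2.2 :=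
    isSigma_inGraph.comp Primrec.snd
  have h4 : IsSigma fun F (q : ℕ × List ℕ × ℕ) =>
      ∃ s, F 1 s = q.1 + 2 ^ Nat.pair (encode q.2.1) q.2.2 :=
    (isSigma_range 1).comp (by fun_prop)
  exact IsPi.and ⟨_, h0, fun F => by simp⟩
    (IsPi.forall_imp (h1.and ((IsSigma.of_primrec h2).and h3)) h4)

theorem isPi_treeCond : IsPi TreeCond :=
  IsPi.forall_imp (isSigma_onTree.comp (f := fun q : List ℕ × ℕ => q.1 ++ [q.2]) (by fun_prop))
    (isSigma_onTree.comp Primrec.fst)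

theorem isPi_smallCond : IsPi SmallCond := by
  have h1 : IsSigma fun F (q : (List ℕ × ℕ) × ℕ) => InGraph F q.1.1 q.2 :=
    isSigma_inGraph.comp (f := fun q : (List ℕ × ℕ) × ℕ => (q.1.1, q.2)) (by fun_prop)
  have h2 : PrimrecPred fun q : (List ℕ × ℕ) × ℕ =>
      posRatCode q.2.unpair.2 < 1 / ((q.1.2 : ℚ) + 1) :=
    (PrimrecRat.posRatCode (by fun_prop)).lt (PrimrecRat.one_div_succ (by fun_prop))
  exact IsPi.forall_imp (isSigma_onTree.comp Primrec.fst)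
    (h1.and (IsSigma.of_primrec h2)).exists'

theorem isPi_compatCond : IsPi (CompatCond C) := by
  have h1 : IsSigma fun F (q : List ℕ × ℕ × ℕ) => InGraph F q.1 q.2.1 :=
    isSigma_inGraph.comp (f := fun q : List ℕ × ℕ × ℕ => (q.1, q.2.1)) (by fun_prop)
  have h2 : IsSigma fun F (q : List ℕ × ℕ × ℕ) => InGraph F q.1 q.2.2 :=
    isSigma_inGraph.comp (f := fun q : List ℕ × ℕ × ℕ => (q.1, q.2.2)) (by fun_prop)
  exact IsPi.forall_imp (h1.and h2) (isSigma_normLt (by fun_prop)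
    ((PrimrecRat.posRatCode (by fun_prop)).add (PrimrecRat.posRatCode (by fun_prop))))

theorem isPi_roundCond : IsPi (RoundCond C) := by
  have h1 : IsSigma fun F (q : (List ℕ × ℕ) × ℕ) => InGraph F q.1.1 q.2 :=
    isSigma_inGraph.comp (f := fun q : (List ℕ × ℕ) × ℕ => (q.1.1, q.2)) (by fun_prop)
  have h2 : IsSigma fun F (q : (List ℕ × ℕ) × ℕ) =>
      NormLt F (C.sub q.1.2.unpair.1 q.2.unpair.1)
        (posRatCode q.1.2.unpair.2 - posRatCode q.2.unpair.2) :=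
    isSigma_normLt (by fun_prop)
      ((PrimrecRat.posRatCode (by fun_prop)).sub (PrimrecRat.posRatCode (by fun_prop)))
  exact IsPi.forall_imp isSigma_inGraph (h1.and h2).exists'

theorem isPi_upwardCond : IsPi (UpwardCond C) := by
  have h1 : IsSigma fun F (q : List ℕ × ℕ × ℕ) => InGraph F q.1 q.2.1 :=
    isSigma_inGraph.comp (f := fun q : List ℕ × ℕ × ℕ => (q.1, q.2.1)) (by fun_prop)
  have h2 : IsSigma fun F (q : List ℕ × ℕ × ℕ) => InGraph F q.1 q.2.2 :=
    isSigma_inGraph.comp (f := fun q : List ℕ × ℕ × ℕ => (q.1, q.2.2)) (by fun_prop)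
  exact IsPi.forall_imp (h1.and (isSigma_normLt (by fun_prop)
    ((PrimrecRat.posRatCode (by fun_prop)).sub (PrimrecRat.posRatCode (by fun_prop))))) h2

theorem primrecPred_incomparable : PrimrecPred Incomparable := by
  have h : PrimrecRel fun e e' : List ℕ × ℕ => e.1 <+: e'.1 :=
    primrecRel_prefix.comp (by fun_prop) (by fun_prop)
  exact primrecPred_pairwise (h.not.and (h.swap.not))

theorem isSigma_powerApprox :
    IsSigma fun F (q : List (List ℕ × ℕ) × ℕ) => PowerApprox C F q.1 q.2 := by
  have h1 : IsSigma fun F (y : (List (List ℕ × ℕ) × ℕ) ×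
      (ℕ × ℕ × ℕ × ℕ × List ((List ℕ × ℕ) × ℕ))) => F 2 y.1.2 = y.2.1 :=
    (IsSigma.oracle 2).comp (f := fun y : (List (List ℕ × ℕ) × ℕ) ×
      (ℕ × ℕ × ℕ × ℕ × List ((List ℕ × ℕ) × ℕ)) => (y.1.2, y.2.1)) (by fun_prop)
  have h2 : PrimrecPred fun (y : (List (List ℕ × ℕ) × ℕ) ×
      (ℕ × ℕ × ℕ × ℕ × List ((List ℕ × ℕ) × ℕ))) =>
      |ratCode y.2.1 - y.2.2.1 * (1 / ((y.2.2.2.1 : ℚ) + 1))| < 1 / ((y.1.2 : ℚ) + 1) :=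
    ((PrimrecRat.ratCode (by fun_prop)).sub ((PrimrecRat.natCast (by fun_prop)).mul
      (PrimrecRat.one_div_succ (by fun_prop)))).abs.lt (PrimrecRat.one_div_succ (by fun_prop))
  have h3 : PrimrecPred fun (y : (List (List ℕ × ℕ) × ℕ) ×
      (ℕ × ℕ × ℕ × ℕ × List ((List ℕ × ℕ) × ℕ))) => y.2.2.2.2.2.map Prod.fst = y.1.1 :=
    primrecPred_eq (primrec_map (by fun_prop) (by fun_prop)) (by fun_prop)
  have h4 : IsSigma fun F (y : (List (List ℕ × ℕ) × ℕ) ×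
      (ℕ × ℕ × ℕ × ℕ × List ((List ℕ × ℕ) × ℕ))) => CombNorm C F (encode ([] : List ℕ)) y.1.1
        (posRatCode y.2.2.2.2.1 ^ (y.2.2.2.1 + 1)) (1 / ((y.1.2 : ℚ) + 1)) :=
    isSigma_combNorm C (by fun_prop) (by fun_prop)
      ((PrimrecRat.posRatCode (by fun_prop)).pow (by fun_prop))
      (PrimrecRat.one_div_succ (by fun_prop))
  have h5 : IsSigma fun F (y : (List (List ℕ × ℕ) × ℕ) ×
      (ℕ × ℕ × ℕ × ℕ × List ((List ℕ × ℕ) × ℕ))) => ∀ t ∈ y.2.2.2.2.2,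
      CombNorm C F (encode ([] : List ℕ)) [t.1] (posRatCode t.2 ^ (y.2.2.2.1 + 1))
        (1 / ((y.1.2 : ℚ) + 1)) := by
    have : IsSigma fun F (z : ((List (List ℕ × ℕ) × ℕ) ×
        (ℕ × ℕ × ℕ × ℕ × List ((List ℕ × ℕ) × ℕ))) × ((List ℕ × ℕ) × ℕ)) =>
        CombNorm C F (encode ([] : List ℕ)) [z.2.1] (posRatCode z.2.2 ^ (z.1.2.2.2.1 + 1))
          (1 / ((z.1.1.2 : ℚ) + 1)) :=
      isSigma_combNorm C (by fun_prop) (by fun_prop)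
        ((PrimrecRat.posRatCode (by fun_prop)).pow (by fun_prop))
        (PrimrecRat.one_div_succ (by fun_prop))
    exact this.forall_mem (by fun_prop)
  have h6 : PrimrecPred fun (y : (List (List ℕ × ℕ) × ℕ) ×
      (ℕ × ℕ × ℕ × ℕ × List ((List ℕ × ℕ) × ℕ))) => |posRatCode y.2.2.2.2.1 ^ y.2.2.1 -
        (y.2.2.2.2.2.map fun t => posRatCode t.2 ^ y.2.2.1).sum| < 1 / ((y.1.2 : ℚ) + 1) := by
    have : PrimrecRat fun (z : ((List (List ℕ × ℕ) × ℕ) ×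
        (ℕ × ℕ × ℕ × ℕ × List ((List ℕ × ℕ) × ℕ))) × ((List ℕ × ℕ) × ℕ)) =>
        posRatCode z.2.2 ^ z.1.2.2.1 := (PrimrecRat.posRatCode (by fun_prop)).pow (by fun_prop)
    have hs : PrimrecRat fun (y : (List (List ℕ × ℕ) × ℕ) ×
        (ℕ × ℕ × ℕ × ℕ × List ((List ℕ × ℕ) × ℕ))) =>
        (y.2.2.2.2.2.map fun t => posRatCode t.2 ^ y.2.2.1).sum :=
      PrimrecRat.list_sum (by fun_prop) this
    have hp : PrimrecRat fun (y : (List (List ℕ × ℕ) × ℕ) ×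
        (ℕ × ℕ × ℕ × ℕ × List ((List ℕ × ℕ) × ℕ))) => posRatCode y.2.2.2.2.1 ^ y.2.2.1 :=
      (PrimrecRat.posRatCode (by fun_prop)).pow (by fun_prop)
    exact (hp.sub hs).abs.lt (PrimrecRat.one_div_succ (by fun_prop))
  exact (h1.and ((IsSigma.of_primrec h2).and ((IsSigma.of_primrec h3).and
    (h4.and (h5.and (IsSigma.of_primrec h6)))))).exists'

theorem isPi_separatingCond : IsPi (SeparatingCond C) := by
  have h1 : IsSigma fun F (q : List (List ℕ × ℕ) × ℕ) => ∀ e ∈ q.1, OnTree F e.1 := by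
    have : IsSigma fun F (z : (List (List ℕ × ℕ) × ℕ) × (List ℕ × ℕ)) => OnTree F z.2.1 :=
      isSigma_onTree.comp (by fun_prop)
    exact this.forall_mem (by fun_prop)
  exact IsPi.forall_imp (h1.and (IsSigma.of_primrec (primrecPred_incomparable.comp Primrec.fst)))
    (isSigma_powerApprox C)

theorem isPi_summativeCond : IsPi (SummativeCond C) := by
  have h1 : IsSigma fun F (q : List ℕ × List ℕ × ℕ) => ∃ a, OnTree F (q.1 ++ [a]) := by
    have : IsSigma fun F (z : (List ℕ × List ℕ × ℕ) × ℕ) => OnTree F (z.1.1 ++ [z.2]) :=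
      isSigma_onTree.comp (by fun_prop)
    exact this.exists'
  have h2 : IsSigma fun F (q : List ℕ × List ℕ × ℕ) => ∀ a ∈ q.2.1, OnTree F (q.1 ++ [a]) := by
    have : IsSigma fun F (z : (List ℕ × List ℕ × ℕ) × ℕ) => OnTree F (z.1.1 ++ [z.2]) :=
      isSigma_onTree.comp (by fun_prop)
    exact this.forall_mem (by fun_prop)
  have h3 : PrimrecPred fun y : (List ℕ × List ℕ × ℕ) × List ℕ => y.2.Nodup :=
    (primrecPred_pairwise Primrec.eq.not).comp Primrec.snd
  have h4 : IsSigma fun _ (y : (List ℕ × List ℕ × ℕ) × List ℕ) => ∀ a ∈ y.1.2.1, a ∈ y.2 := by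
    have hm : PrimrecRel fun (l : List ℕ) (a : ℕ) => a ∈ l :=
      (PrimrecRel.exists_mem_list Primrec.eq).of_eq fun l a => by simp
    have : IsSigma fun _ (z : ((List ℕ × List ℕ × ℕ) × List ℕ) × ℕ) => z.2 ∈ z.1.2 :=
      IsSigma.of_primrec (hm.comp (by fun_prop) (by fun_prop))
    exact this.forall_mem (by fun_prop)
  have h5 : IsSigma fun F (y : (List ℕ × List ℕ × ℕ) × List ℕ) =>
      CombNorm C F (encode ([] : List ℕ)) (childrenComb C y.1.1 y.2) 0
        (1 / ((y.1.2.2 : ℚ) + 1)) :=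
    isSigma_combNorm C (by fun_prop) (primrec_cons (by fun_prop)
      (primrec_map (g := fun (y : (List ℕ × List ℕ × ℕ) × List ℕ) a => (y.1.1 ++ [a], C.one)) (by fun_prop) (by fun_prop)))
      (by exact_mod_cast PrimrecRat.const_nat 0) (PrimrecRat.one_div_succ (by fun_prop))
  exact IsPi.forall_imp (h1.and h2) ((IsSigma.of_primrec h3).and (h4.and h5)).exists'

theorem isPi_nonzeroCond : IsPi (NonzeroCond C) := by
  have h : IsSigma fun F (y : List ℕ × ℕ) => CombNorm C F (encode ([] : List ℕ))
      [(y.1, C.one)] (posRatCode y.2) (posRatCode y.2) :=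
    isSigma_combNorm C (by fun_prop) (by fun_prop) (PrimrecRat.posRatCode (by fun_prop))
      (PrimrecRat.posRatCode (by fun_prop))
  exact IsPi.forall_imp isSigma_onTree h.exists'

theorem isPi_injectiveCond : IsPi (InjectiveCond C) := by
  have h : IsSigma fun F (y : (List ℕ × List ℕ) × ℕ) => CombNorm C F (encode ([] : List ℕ))
      [(y.1.1, C.one), (y.1.2, C.negOne)] (posRatCode y.2) (posRatCode y.2) :=
    isSigma_combNorm C (by fun_prop) (by fun_prop) (PrimrecRat.posRatCode (by fun_prop))
      (PrimrecRat.posRatCode (by fun_prop))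
  exact IsPi.forall_imp ((isSigma_onTree.comp Primrec.fst).and ((isSigma_onTree.comp
    Primrec.snd).and (IsSigma.of_primrec (primrecPred_eq Primrec.fst Primrec.snd).not))) h.exists'

theorem isPi_denseCond : IsPi (DenseCond C) := by
  have h : IsSigma fun F (y : (ℕ × ℕ) × List (List ℕ × ℕ)) =>
      CombNorm C F y.1.1 y.2 0 (1 / ((y.1.2 : ℚ) + 1)) :=
    isSigma_combNorm C (by fun_prop) (by fun_prop) (by exact_mod_cast PrimrecRat.const_nat 0)
      (PrimrecRat.one_div_succ (by fun_prop))
  have ht : PrimrecPred fun _ : ℕ × ℕ => True :=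
    (primrecPred_eq (Primrec.const 0) (Primrec.const 0)).of_eq fun _ => by simp
  exact IsPi.forall_imp (IsSigma.of_primrec ht) h.exists'

theorem isPi02_cond : IsPi02 fun F => TreeNameCond C F ∧ DisintegrationCond C F :=
  (IsPi.and (isPi_enumerationCond.and (isPi_treeCond.and (isPi_smallCond.and
    ((isPi_compatCond C).and ((isPi_roundCond C).and (isPi_upwardCond C))))))
    ((isPi_separatingCond C).and ((isPi_summativeCond C).and ((isPi_nonzeroCond C).and
      ((isPi_injectiveCond C).and (isPi_denseCond C)))))).isPi02

end Complexity

open Filter Topology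

universe u v

/-! ### Approximation of reals by rational intervals and of vectors by rational balls -/

theorem exists_posRatCode_mem_Ioo {x y : ℝ} (hx : 0 ≤ x) (hxy : x < y) :
    ∃ n, x < posRatCode n ∧ (posRatCode n : ℝ) < y := by
  obtain ⟨q, h1, h2⟩ := exists_rat_btwn hxy
  have hq : 0 < q := by exact_mod_cast hx.trans_lt h1
  obtain ⟨n, rfl⟩ := exists_posRatCode_eq hq
  exact ⟨n, h1, h2⟩

theorem posRatCode_cast_pos (n : ℕ) : (0 : ℝ) < posRatCode n := by
  exact_mod_cast posRatCode_pos n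

theorem exists_mem_ratInterval (x : ℝ) {ε : ℝ} (hε : 0 < ε) :
    ∃ i, x ∈ ratInterval i ∧ (posRatCode i.unpair.2 : ℝ) < ε := by
  obtain ⟨n, h1, h2⟩ := exists_posRatCode_mem_Ioo le_rfl hε
  obtain ⟨q, h3, h4⟩ := exists_rat_btwn (sub_lt_self x h1)
  obtain ⟨m, rfl⟩ := exists_ratCode_eq q
  refine ⟨Nat.pair m n, ?_, by simpa using h2⟩
  rw [ratInterval, Nat.unpair_pair, Metric.mem_ball, Real.dist_eq, abs_lt]
  constructor <;> linarith

/-- Positivity in the shape of `CombNorm`: an interval whose center equals its radius has left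
endpoint `0`. -/
theorem exists_posRatCode_abs_sub_lt_iff {x : ℝ} :
    (∃ i, |x - posRatCode i| < posRatCode i) ↔ 0 < x := by
  constructor
  · rintro ⟨i, hi⟩
    linarith [(abs_lt.1 hi).1]
  · intro hx
    obtain ⟨i, hi, _⟩ := exists_posRatCode_mem_Ioo hx.le (lt_add_one x)
    exact ⟨i, by rw [abs_lt]; constructor <;> linarith⟩

section Correctness

variable {𝕜 : Type u} [RCLike 𝕜] {B : Type v} [NormedAddCommGroup B] [NormedSpace 𝕜 B]
  {R : ℕ → B} {C : VectorArithmetic.{v} 𝕜} {F : Fin 3 → ℕ → ℕ}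

theorem mem_ratBall {n : ℕ} {v : B} :
    v ∈ ratBall 𝕜 R n ↔ ‖v - ratVec 𝕜 R n.unpair.1‖ < posRatCode n.unpair.2 := by
  rw [ratBall, Metric.mem_ball, dist_eq_norm]

theorem exists_mem_ratBall (hR : IsPresentation 𝕜 R) (v : B) {ε : ℝ} (hε : 0 < ε) :
    ∃ n, v ∈ ratBall 𝕜 R n ∧ (posRatCode n.unpair.2 : ℝ) < ε := by
  obtain ⟨n, h1, h2⟩ := exists_posRatCode_mem_Ioo le_rfl hε
  obtain ⟨m, hm⟩ := (denseRange_ratVec hR).exists_dist_lt v h1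
  exact ⟨Nat.pair m n, by simpa [ratBall] using hm, by simpa using h2⟩

theorem inDiagram_iff (hF : NamesPresentation 𝕜 (F 0) R) {m i : ℕ} :
    InDiagram F (Nat.pair m i) ↔ |‖ratVec 𝕜 R m‖ - ratCode i.unpair.1| < posRatCode i.unpair.2 := by
  have : InDiagram F (Nat.pair m i) ↔ Nat.pair m i ∈ Set.range (F 0) := Iff.rfl
  rw [this, hF]
  simp [diagram, ratInterval, Real.dist_eq]

theorem normLt_iff (hF : NamesPresentation 𝕜 (F 0) R) {m : ℕ} {q : ℚ} :
    NormLt F m q ↔ ‖ratVec 𝕜 R m‖ < q := by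
  constructor
  · rintro ⟨i, hi, hq⟩
    rw [inDiagram_iff hF] at hi
    have hq : (ratCode i.unpair.1 : ℝ) + posRatCode i.unpair.2 ≤ q := by exact_mod_cast hq
    linarith [(abs_lt.1 hi).2]
  · intro h
    -- The right endpoint exceeds the norm by less than twice the radius, so half of the gap
    -- suffices.
    obtain ⟨i, hi, hr⟩ := exists_mem_ratInterval ‖ratVec 𝕜 R m‖ (half_pos (sub_pos.2 h))
    rw [ratInterval, Metric.mem_ball, Real.dist_eq] at hi
    refine ⟨i, (inDiagram_iff hF).2 hi, ?_⟩
    have : (ratCode i.unpair.1 : ℝ) + posRatCode i.unpair.2 ≤ q := by linarith [(abs_lt.1 hi).1]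
    exact_mod_cast this

theorem ratVec_sub (C : VectorArithmetic.{v} 𝕜) (a b : ℕ) :
    ratVec 𝕜 R (C.sub a b) = ratVec 𝕜 R a - ratVec 𝕜 R b := by
  rw [VectorArithmetic.sub, C.ratVec_add, C.ratVec_smul, C.scalarCode_negOne, neg_one_smul,
    sub_eq_add_neg]

variable (𝕜) in
/-- The value of a coded linear combination of vectors. -/
noncomputable def comb (vec : List ℕ → B) (L : List (List ℕ × ℕ)) : B :=
  (L.map fun e => scalarCode 𝕜 e.2 • vec e.1).sum

/-- Triangle inequality: a term contributes the norm of its scalar, at most twice the code, times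
the distance to the center, less than the radius. -/
theorem norm_combCode_sub_le {vec : List ℕ → B} (c : ℕ) {T : List (List ℕ × ℕ × ℕ)}
    (hT : ∀ t ∈ T, vec t.1 ∈ ratBall 𝕜 R t.2.2) :
    ‖ratVec 𝕜 R (C.combCode T c) -
      (ratVec 𝕜 R c + comb 𝕜 vec (T.map fun t => (t.1, t.2.1)))‖ ≤ combErr T := by
  induction T with
  | nil => simp [VectorArithmetic.combCode, comb, combErr]
  | cons t T ih =>
    have ih := ih fun s hs => hT s (List.mem_cons_of_mem _ hs)
    have h1 := mem_ratBall.1 (hT t List.mem_cons_self)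
    have h2 : C.combCode (t :: T) c = C.add (C.smul t.2.1 t.2.2.unpair.1) (C.combCode T c) := rfl
    have h3 : combErr (t :: T) = 2 * (t.2.1 : ℚ) * posRatCode t.2.2.unpair.2 + combErr T := by
      simp [combErr]
    have h4 : comb 𝕜 vec ((t :: T).map fun t => (t.1, t.2.1)) =
        scalarCode 𝕜 t.2.1 • vec t.1 + comb 𝕜 vec (T.map fun t => (t.1, t.2.1)) := by
      simp [comb]
    rw [h2, h3, h4, C.ratVec_add, C.ratVec_smul]
    have h5 : scalarCode 𝕜 t.2.1 • ratVec 𝕜 R t.2.2.unpair.1 + ratVec 𝕜 R (C.combCode T c) -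
        (ratVec 𝕜 R c + (scalarCode 𝕜 t.2.1 • vec t.1 +
          comb 𝕜 vec (T.map fun t => (t.1, t.2.1)))) =
        -(scalarCode 𝕜 t.2.1 • (vec t.1 - ratVec 𝕜 R t.2.2.unpair.1)) +
        (ratVec 𝕜 R (C.combCode T c) -
          (ratVec 𝕜 R c + comb 𝕜 vec (T.map fun t => (t.1, t.2.1)))) := by
      rw [smul_sub]
      abel
    rw [h5]
    refine (norm_add_le _ _).trans ?_
    rw [norm_neg, norm_smul]
    push_cast
    refine add_le_add (mul_le_mul (norm_scalarCode_le 𝕜 _) h1.le (norm_nonneg _) (by positivity)) ih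

theorem exists_combErr_lt (hR : IsPresentation 𝕜 R) (vec : List ℕ → B) (L : List (List ℕ × ℕ))
    {ε : ℝ} (hε : 0 < ε) : ∃ T : List (List ℕ × ℕ × ℕ), T.map (fun t => (t.1, t.2.1)) = L ∧
      (∀ t ∈ T, vec t.1 ∈ ratBall 𝕜 R t.2.2) ∧ (combErr T : ℝ) < ε := by
  induction L generalizing ε with
  | nil => exact ⟨[], by simp [combErr, hε]⟩
  | cons e L ih =>
    obtain ⟨T, h1, h2, h3⟩ := ih (half_pos hε)
    -- With radius below `ε / (4α + 4)` the new term `2 * α * radius` stays below `ε / 2`; the added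
    -- `4` keeps the divisor positive when the code `α` is `0`.
    have hpos : (0 : ℝ) < 4 * e.2 + 4 := by positivity
    obtain ⟨n, hn, hr⟩ := exists_mem_ratBall hR (vec e.1) (div_pos hε hpos)
    refine ⟨(e.1, e.2, n) :: T, by simp [h1], ?_, ?_⟩
    · simpa [hn] using h2
    · have h4 : combErr ((e.1, e.2, n) :: T) =
          2 * (e.2 : ℚ) * posRatCode n.unpair.2 + combErr T := by simp [combErr]
      rw [h4]
      push_cast
      rw [lt_div_iff₀ hpos] at hr
      nlinarith [posRatCode_cast_pos n.unpair.2]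

/-- `F 1` lists the graph of a vector tree with the nodes `dom` and the vectors `vec`. -/
def ListsGraph (𝕜 : Type*) [RCLike 𝕜] {B : Type*} [NormedAddCommGroup B] [NormedSpace 𝕜 B]
    (F : Fin 3 → ℕ → ℕ) (R : ℕ → B) (dom : Set (List ℕ)) (vec : List ℕ → B) : Prop :=
  ∀ ν n, InGraph F ν n ↔ ν ∈ dom ∧ vec ν ∈ ratBall 𝕜 R n

variable {dom : Set (List ℕ)} {vec : List ℕ → B}

theorem ListsGraph.onTree_iff (hG : ListsGraph 𝕜 F R dom vec) (hR : IsPresentation 𝕜 R)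
    {ν : List ℕ} : OnTree F ν ↔ ν ∈ dom := by
  constructor
  · rintro ⟨n, hn⟩
    exact ((hG ν n).1 hn).1
  · intro h
    obtain ⟨n, hn, _⟩ := exists_mem_ratBall hR (vec ν) one_pos
    exact ⟨n, (hG ν n).2 ⟨h, hn⟩⟩

/-- The bridge from names to analysis: the conditions on a disintegration become statements about
actual norms. -/
theorem combNorm_iff (hR : IsPresentation 𝕜 R) (hF : NamesPresentation 𝕜 (F 0) R)
    (hG : ListsGraph 𝕜 F R dom vec) {c : ℕ} {L : List (List ℕ × ℕ)} {x r : ℚ} :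
    CombNorm C F c L x r ↔
      (∀ e ∈ L, e.1 ∈ dom) ∧ |‖ratVec 𝕜 R c + comb 𝕜 vec L‖ - x| < r := by
  constructor
  · rintro ⟨T, j, rfl, hT, hj, hr⟩
    have hT' := fun t ht => (hG _ _).1 (hT t ht)
    refine ⟨fun e he => ?_, ?_⟩
    · obtain ⟨t, ht, rfl⟩ := List.mem_map.1 he
      exact (hT' t ht).1
    · have h1 := norm_combCode_sub_le (C := C) c fun t ht => (hT' t ht).2
      have h2 := (inDiagram_iff hF).1 hj
      have h3 : |(ratCode j.unpair.1 : ℝ) - x| + posRatCode j.unpair.2 + combErr T < r := by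
        exact_mod_cast hr
      have h4 := (abs_norm_sub_norm_le _ _).trans h1
      rw [abs_le] at h4
      rw [abs_lt] at h2 ⊢
      have h5 := le_abs_self ((ratCode j.unpair.1 : ℝ) - x)
      have h6 := neg_abs_le ((ratCode j.unpair.1 : ℝ) - x)
      constructor <;> linarith [h4.1, h4.2, h2.1, h2.2]
  · rintro ⟨hL, hr⟩
    -- Four errors share the gap: the radius of the interval and `combErr` each occur explicitly in
    -- `CombNorm` and once more in the estimate of `|ratCode - x|`.
    have hη : 0 < (r - |‖ratVec 𝕜 R c + comb 𝕜 vec L‖ - x|) / 4 := by linarith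
    obtain ⟨T, rfl, hT, hlt⟩ := exists_combErr_lt hR vec L hη
    have h1 := norm_combCode_sub_le (C := C) c hT
    obtain ⟨j, hj, hjr⟩ := exists_mem_ratInterval ‖ratVec 𝕜 R (C.combCode T c)‖ hη
    rw [ratInterval, Metric.mem_ball, Real.dist_eq] at hj
    refine ⟨T, j, rfl, fun t ht => (hG _ _).2 ⟨hL (t.1, t.2.1) (List.mem_map.2 ⟨t, ht, rfl⟩),
      hT t ht⟩, (inDiagram_iff hF).2 hj, ?_⟩
    have h4 := (abs_norm_sub_norm_le _ _).trans h1
    have key : |(ratCode j.unpair.1 : ℝ) - x| + posRatCode j.unpair.2 + combErr T < r := by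
      have h7 : |(ratCode j.unpair.1 : ℝ) - x| ≤
          |‖ratVec 𝕜 R (C.combCode T c)‖ - ratCode j.unpair.1| +
          |‖ratVec 𝕜 R (C.combCode T c)‖ - ‖ratVec 𝕜 R c + comb 𝕜 vec (T.map
            fun t => (t.1, t.2.1))‖| +
          |‖ratVec 𝕜 R c + comb 𝕜 vec (T.map fun t => (t.1, t.2.1))‖ - x| := by
        rw [abs_sub_comm ‖ratVec 𝕜 R (C.combCode T c)‖ (ratCode j.unpair.1 : ℝ)]
        exact (abs_sub_le _ ‖ratVec 𝕜 R c + comb 𝕜 vec (T.map fun t => (t.1, t.2.1))‖ _).trans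
          (add_le_add_left (abs_sub_le _ _ _) _)
      linarith
    exact_mod_cast key

/-! ### Names of vector trees -/

/-- A finite set arises from the empty one by adjoining its elements in increasing order. In binary,
adjoining an element `i` above all others is the addition of `2 ^ i`. -/
theorem names_iff {g : ℕ → ℕ} {φ : VectorTree B} (hg : F 1 = g) (hG : ListsGraph 𝕜 F R φ.dom φ.vec) :
    φ.Names 𝕜 g R ↔ EnumerationCond F := by
  subst hg
  have hmem : ∀ i, i ∈ φ.graphCodes 𝕜 R ↔ ∃ s, (F 1 s).testBit i = true := fun i => by
    have := hG (Denumerable.ofNat (List ℕ) i.unpair.1) i.unpair.2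
    rw [InGraph, Denumerable.encode_ofNat, Nat.pair_unpair] at this
    exact this.symm
  have hcode : ∀ ν n, InGraph F ν n ↔ ∃ s, (F 1 s).testBit (Nat.pair (encode ν) n) = true :=
    fun _ _ => Iff.rfl
  rw [VectorTree.Names, EnumerationCond]
  constructor
  · intro H
    have H' : ∀ k, (∃ s, F 1 s = k) ↔ finiteSetCode k ⊆ φ.graphCodes 𝕜 R :=
      fun k => Set.ext_iff.1 H k
    refine ⟨(H' 0).2 fun i hi => by simp [finiteSetCode] at hi, ?_⟩
    rintro ⟨k, ν, n⟩ ⟨hk, hlt, hn⟩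
    refine (H' _).2 fun i hi => ?_
    dsimp only at hlt hk hn hi
    rw [hcode, ← hmem] at hn
    have hi : (k + 2 ^ Nat.pair (encode ν) n).testBit i = true := hi
    rw [add_comm] at hi
    rcases lt_trichotomy i (Nat.pair (encode ν) n) with h | h | h
    · rw [Nat.testBit_two_pow_add_gt h] at hi
      exact (H' k).1 hk hi
    · rwa [h]
    · rw [Nat.testBit_lt_two_pow] at hi
      · simp at hi
      · have : 2 ^ (Nat.pair (encode ν) n + 1) ≤ 2 ^ i := Nat.pow_le_pow_right two_pos h
        rw [pow_succ] at this
        lia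
  · rintro ⟨h0, hstep⟩
    refine Set.Subset.antisymm ?_ ?_
    · rintro _ ⟨s, rfl⟩ i hi
      exact (hmem i).2 ⟨s, hi⟩
    · intro k
      induction k using Nat.strong_induction_on with
      | _ k ih =>
        intro hk
        rcases Nat.eq_zero_or_pos k with rfl | hpos
        · exact h0
        · have hle := Nat.log2_self_le hpos.ne'
          have hlt : k < 2 ^ (k.log2 + 1) := Nat.lt_log2_self
          rw [pow_succ] at hlt
          -- `i` is the largest element of the set coded by `k`; the remainder `k'` codes the other
          -- elements.
          set i := k.log2 with hi
          obtain ⟨k', hk'⟩ := Nat.exists_eq_add_of_le hle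
          have hk2 : k' < 2 ^ i := by lia
          have hii : i ∈ φ.graphCodes 𝕜 R := hk (by
            change k.testBit i = true
            rw [hk', Nat.testBit_two_pow_add_eq, Nat.testBit_lt_two_pow hk2]
            rfl)
          have hsub : k' ∈ Set.range (F 1) := by
            refine ih k' (by have := Nat.two_pow_pos i; lia) fun j hj => hk ?_
            have hj : k'.testBit j = true := hj
            change k.testBit j = true
            have hji : j < i := by
              by_contra hcon
              rw [Nat.testBit_lt_two_pow (hk2.trans_le (Nat.pow_le_pow_right two_pos
                (not_lt.1 hcon)))] at hj
              simp at hj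
            rw [hk', Nat.testBit_two_pow_add_gt hji, hj]
          have hpair : Nat.pair (encode (Denumerable.ofNat (List ℕ) i.unpair.1)) i.unpair.2 = i := by
            rw [Denumerable.encode_ofNat, Nat.pair_unpair]
          have := hstep (k', Denumerable.ofNat (List ℕ) i.unpair.1, i.unpair.2)
            ⟨hsub, by rw [hpair]; exact hk2, by rw [hcode, hpair]; exact (hmem i).1 hii⟩
          rw [hpair] at this
          rwa [hk', add_comm]

theorem listsGraph_of_names {g : ℕ → ℕ} {φ : VectorTree B} (hg : F 1 = g)
    (h : φ.Names 𝕜 g R) : ListsGraph 𝕜 F R φ.dom φ.vec := by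
  subst hg
  intro ν n
  have hmem : Nat.pair (encode ν) n ∈ φ.graphCodes 𝕜 R ↔ ν ∈ φ.dom ∧ φ.vec ν ∈ ratBall 𝕜 R n := by
    simp [VectorTree.graphCodes]
  rw [← hmem]
  have H : ∀ k, (∃ s, F 1 s = k) ↔ finiteSetCode k ⊆ φ.graphCodes 𝕜 R := fun k => Set.ext_iff.1 h k
  constructor
  · rintro ⟨s, hs⟩
    exact (H _).1 ⟨s, rfl⟩ hs
  · intro hi
    -- The singleton is one of the listed finite sets.
    obtain ⟨s, hs⟩ := (H (2 ^ Nat.pair (encode ν) n)).2 fun j hj => by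
      have hj : (2 ^ Nat.pair (encode ν) n).testBit j = true := hj
      rw [Nat.testBit_two_pow] at hj
      rwa [← of_decide_eq_true hj]
    exact ⟨s, by rw [hs, Nat.testBit_two_pow_self]⟩

theorem treeNameCond_of_names (hR : IsPresentation 𝕜 R) (hF : NamesPresentation 𝕜 (F 0) R)
    {φ : VectorTree B} (h : φ.Names 𝕜 (F 1) R) : TreeNameCond C F := by
  have hG := listsGraph_of_names rfl h
  refine ⟨(names_iff rfl hG).1 h, ?_, ?_, ?_, ?_, ?_⟩
  · rintro ⟨ν, a⟩ hν
    rw [hG.onTree_iff hR] at hν ⊢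
    exact φ.isTree _ hν _ (List.prefix_append _ _)
  · rintro ⟨ν, k⟩ hν
    rw [hG.onTree_iff hR] at hν
    obtain ⟨n, hn, hlt⟩ := exists_mem_ratBall (𝕜 := 𝕜) hR (φ.vec ν) (Nat.one_div_pos_of_nat (n := k))
    exact ⟨n, (hG ν n).2 ⟨hν, hn⟩, Rat.cast_lt (K := ℝ).1 (by push_cast; exact hlt)⟩
  · rintro ⟨ν, n, m⟩ ⟨hn, hm⟩
    have hn := mem_ratBall.1 ((hG _ _).1 hn).2
    have hm := mem_ratBall.1 ((hG _ _).1 hm).2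
    rw [normLt_iff hF, ratVec_sub]
    push_cast
    have := norm_sub_le_norm_sub_add_norm_sub (ratVec 𝕜 R n.unpair.1) (φ.vec ν)
      (ratVec 𝕜 R m.unpair.1)
    rw [norm_sub_rev _ (φ.vec ν)] at this
    linarith
  · rintro ⟨ν, n⟩ hn
    obtain ⟨hν, hn⟩ := (hG _ _).1 hn
    have hn := mem_ratBall.1 hn
    -- The radius of `m` is spent twice, on the distance from its center to the vector and in the
    -- formal inclusion.
    obtain ⟨m, hm, hlt⟩ := exists_mem_ratBall (𝕜 := 𝕜) hR (φ.vec ν) (half_pos (sub_pos.2 hn))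
    refine ⟨m, (hG _ _).2 ⟨hν, hm⟩, ?_⟩
    have hm := mem_ratBall.1 hm
    rw [normLt_iff hF, ratVec_sub]
    push_cast
    have := norm_sub_le_norm_sub_add_norm_sub (ratVec 𝕜 R n.unpair.1) (φ.vec ν)
      (ratVec 𝕜 R m.unpair.1)
    rw [norm_sub_rev _ (φ.vec ν)] at this
    linarith
  · rintro ⟨ν, n, m⟩ ⟨hn, hlt⟩
    obtain ⟨hν, hn⟩ := (hG _ _).1 hn
    refine (hG _ _).2 ⟨hν, mem_ratBall.2 ?_⟩
    have hn := mem_ratBall.1 hn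
    rw [normLt_iff hF, ratVec_sub] at hlt
    push_cast at hlt
    have := norm_sub_le_norm_sub_add_norm_sub (φ.vec ν) (ratVec 𝕜 R n.unpair.1)
      (ratVec 𝕜 R m.unpair.1)
    linarith

/-- Compatibility makes the centers of shrinking listed balls a Cauchy sequence, whose limit lies in
the closure of every listed ball. Roundness improves this to the open ball, and upward closure shows
that every ball containing the limit is listed. -/
theorem exists_vec_of_treeNameCond [CompleteSpace B] (hF : NamesPresentation 𝕜 (F 0) R)
    (h : TreeNameCond C F) : ∃ vec : List ℕ → B, ListsGraph 𝕜 F R {ν | OnTree F ν} vec := by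
  obtain ⟨-, -, hsmall, hcompat, hround, hup⟩ := h
  suffices H : ∀ ν, ∃ v : B, ∀ n, InGraph F ν n ↔ OnTree F ν ∧ v ∈ ratBall 𝕜 R n by
    choose vec hvec using H
    exact ⟨vec, hvec⟩
  intro ν
  by_cases hν : OnTree F ν
  swap
  · exact ⟨0, fun n => ⟨fun hn => absurd ⟨n, hn⟩ hν, fun hn => absurd hn.1 hν⟩⟩
  choose b hb hbr using fun k : ℕ => hsmall (ν, k) hν
  dsimp only at hb hbr
  have hbr' : ∀ k, (posRatCode (b k).unpair.2 : ℝ) < 1 / ((k : ℝ) + 1) := fun k => by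
    have := Rat.cast_lt (K := ℝ).2 (hbr k)
    push_cast at this
    exact this
  have hdist : ∀ n k, InGraph F ν n → ‖ratVec 𝕜 R n.unpair.1 - ratVec 𝕜 R (b k).unpair.1‖ <
      posRatCode n.unpair.2 + 1 / ((k : ℝ) + 1) := fun n k hn => by
    have := hcompat (ν, n, b k) ⟨hn, hb k⟩
    rw [normLt_iff hF, ratVec_sub] at this
    push_cast at this
    linarith [hbr' k]
  have hlim := tendsto_one_div_add_atTop_nhds_zero_nat (𝕜 := ℝ)
  have hcauchy : CauchySeq fun k => ratVec 𝕜 R (b k).unpair.1 := by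
    refine cauchySeq_of_le_tendsto_0 (fun N : ℕ => 2 * (1 / ((N : ℝ) + 1))) (fun n m N hn hm => ?_)
      (by simpa using hlim.const_mul 2)
    have h1 := hdist (b n) m (hb n)
    have h2 := Nat.one_div_le_one_div (α := ℝ) hn
    have h3 := Nat.one_div_le_one_div (α := ℝ) hm
    rw [dist_eq_norm]
    linarith [hbr' n]
  obtain ⟨v, hv⟩ := cauchySeq_tendsto_of_complete hcauchy
  have hle : ∀ n, InGraph F ν n → ‖v - ratVec 𝕜 R n.unpair.1‖ ≤ posRatCode n.unpair.2 :=
    fun n hn => by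
      rw [norm_sub_rev]
      have h1 : Tendsto (fun k : ℕ => (posRatCode n.unpair.2 : ℝ) + 1 / ((k : ℝ) + 1)) atTop
          (𝓝 (posRatCode n.unpair.2 + 0)) := hlim.const_add _
      rw [add_zero] at h1
      exact le_of_tendsto_of_tendsto (tendsto_const_nhds.sub hv).norm h1
        (Eventually.of_forall fun k => (hdist n k hn).le)
  refine ⟨v, fun n => ⟨fun hn => ⟨hν, mem_ratBall.2 ?_⟩, fun hn => ?_⟩⟩
  -- The limit is known only up to a non-strict inequality for `m`; the strict formal inclusion of
  -- `m` in `n` makes the inequality for `n` strict.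
  · obtain ⟨m, hm, hlt⟩ := hround (ν, n) hn
    rw [normLt_iff hF, ratVec_sub, norm_sub_rev] at hlt
    push_cast at hlt
    have := norm_sub_le_norm_sub_add_norm_sub v (ratVec 𝕜 R m.unpair.1) (ratVec 𝕜 R n.unpair.1)
    linarith [hle m hm]
  · have hn := mem_ratBall.1 hn.2
    obtain ⟨k, hk⟩ := exists_nat_one_div_lt (half_pos (sub_pos.2 hn))
    refine hup (ν, b k, n) ⟨hb k, ?_⟩
    rw [normLt_iff hF, ratVec_sub]
    push_cast
    have := norm_sub_le_norm_sub_add_norm_sub (ratVec 𝕜 R (b k).unpair.1) v (ratVec 𝕜 R n.unpair.1)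
    have h1 := hle _ (hb k)
    rw [norm_sub_rev] at h1
    linarith [hbr' k]

end Correctness

/-! ### Real powers through powers with natural exponents -/

/-- For a base `s ^ (b + 1)` the exponent `a / (b + 1)` yields a natural power of `s`, which is
rational when `s` is. -/
theorem pow_rpow_natCast_div {s : ℝ} (hs : 0 ≤ s) (a b : ℕ) :
    (s ^ (b + 1)) ^ ((a : ℝ) * (1 / ((b : ℝ) + 1))) = s ^ a := by
  have hb : (b : ℝ) + 1 ≠ 0 := by positivity
  rw [← Real.rpow_natCast, ← Real.rpow_mul hs, ← Real.rpow_natCast s a]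
  congr 1
  push_cast
  field_simp

theorem exists_posRatCode_pow_near (b : ℕ) {x : ℝ} (hx : 0 ≤ x) {ε : ℝ} (hε : 0 < ε) :
    ∃ m, |(posRatCode m : ℝ) ^ (b + 1) - x| < ε := by
  set y := x ^ (((b + 1 : ℕ) : ℝ)⁻¹) with hy
  have hyx : y ^ (b + 1) = x := Real.rpow_inv_natCast_pow hx (Nat.succ_ne_zero b)
  have hcont : ContinuousAt (fun z : ℝ => z ^ (b + 1)) y := (continuous_pow (b + 1)).continuousAt
  obtain ⟨δ, hδ, h⟩ := Metric.continuousAt_iff.1 hcont ε hε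
  obtain ⟨m, h1, h2⟩ := exists_posRatCode_mem_Ioo (Real.rpow_nonneg hx _) (lt_add_of_pos_right y hδ)
  refine ⟨m, ?_⟩
  have := h (x := posRatCode m) (by rw [Real.dist_eq, abs_lt]; constructor <;> linarith)
  rwa [Real.dist_eq, hyx] at this

theorem exists_natCast_div_near {p δ : ℝ} (hp : 0 ≤ p) (hδ : 0 < δ) :
    ∃ a b : ℕ, |(a : ℝ) * (1 / ((b : ℝ) + 1)) - p| < δ := by
  obtain ⟨m, h1, h2⟩ := exists_posRatCode_mem_Ioo hp (lt_add_of_pos_right p hδ)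
  refine ⟨m.unpair.1 + 1, m.unpair.2, ?_⟩
  have : ((m.unpair.1 + 1 : ℕ) : ℝ) * (1 / ((m.unpair.2 : ℝ) + 1)) = posRatCode m := by
    rw [posRatCode]
    push_cast
    ring
  rw [this, abs_lt]
  constructor <;> linarith

/-- An equation between real powers holds approximately for powers of rational numbers. -/
theorem exists_pow_approx {n : ℕ} {p X q : ℝ} {x : Fin n → ℝ} (hp : 1 ≤ p) (hX : 0 ≤ X)
    (hx : ∀ j, 0 ≤ x j) (h : X ^ p = ∑ j, x j ^ p) {ε : ℝ} (hq : |q - p| < ε) :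
    ∃ (a b s : ℕ) (t : Fin n → ℕ), |q - a * (1 / ((b : ℝ) + 1))| < ε ∧
      |X - (posRatCode s : ℝ) ^ (b + 1)| < ε ∧ (∀ j, |x j - (posRatCode (t j) : ℝ) ^ (b + 1)| < ε) ∧
      |(posRatCode s : ℝ) ^ a - ∑ j, (posRatCode (t j) : ℝ) ^ a| < ε := by
  have hε : 0 < ε := (abs_nonneg _).trans_lt hq
  have hp0 : 0 < p := by linarith
  -- Real powers are jointly continuous in base and exponent where the exponent is positive, even at
  -- base `0`.
  have hcont : ContinuousAt (fun z : ℝ × ℝ × (Fin n → ℝ) =>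
      z.2.1 ^ z.1 - ∑ j, z.2.2 j ^ z.1) (p, X, x) := by
    have hpow : ∀ f : ℝ × ℝ × (Fin n → ℝ) → ℝ, Continuous f →
        ContinuousAt (fun z => f z ^ z.1) (p, X, x) := fun f hf =>
      hf.continuousAt.rpow continuous_fst.continuousAt (Or.inr hp0)
    refine (hpow _ (by fun_prop)).sub ?_
    exact tendsto_finsetSum _ fun j _ => hpow (fun z => z.2.2 j) (by fun_prop)
  obtain ⟨δ, hδ, H⟩ := Metric.continuousAt_iff.1 hcont ε hε
  -- The bound `ε - |q - p|` keeps the exponent within `ε` of `q`, the approximation provided by the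
  -- name of `p`.
  obtain ⟨a, b, hab⟩ := exists_natCast_div_near hp0.le (lt_min hδ (sub_pos.2 hq))
  obtain ⟨s, hs⟩ := exists_posRatCode_pow_near b hX (lt_min hδ hε)
  choose t ht using fun j => exists_posRatCode_pow_near b (hx j) (lt_min hδ hε)
  refine ⟨a, b, s, t, ?_, ?_, fun j => ?_, ?_⟩
  · have h1 := abs_sub_le q p (a * (1 / ((b : ℝ) + 1)))
    rw [abs_sub_comm p] at h1
    linarith [hab.trans_le (min_le_right _ _)]
  · rw [abs_sub_comm]
    exact hs.trans_le (min_le_right _ _)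
  · rw [abs_sub_comm]
    exact (ht j).trans_le (min_le_right _ _)
  · have := H (x := ((a : ℝ) * (1 / ((b : ℝ) + 1)), (posRatCode s : ℝ) ^ (b + 1),
      fun j => (posRatCode (t j) : ℝ) ^ (b + 1))) (by
        rw [Prod.dist_eq, Prod.dist_eq, max_lt_iff, max_lt_iff, dist_pi_lt_iff hδ]
        exact ⟨hab.trans_le (min_le_left _ _), hs.trans_le (min_le_left _ _),
          fun j => (ht j).trans_le (min_le_left _ _)⟩)
    dsimp only at this
    rw [h, sub_self, Real.dist_eq, sub_zero, pow_rpow_natCast_div (posRatCode_cast_pos s).le] at this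
    simpa only [pow_rpow_natCast_div (posRatCode_cast_pos _).le] using this

/-- Exponents and bases converge as `k` grows, so by joint continuity the approximate equations pass
to the limit. -/
theorem pow_eq_of_approx {n : ℕ} {p X : ℝ} {x : Fin n → ℝ} (hp : 1 ≤ p) {q : ℕ → ℝ}
    (hq : Tendsto q atTop (𝓝 p))
    (H : ∀ k : ℕ, ∃ (a b s : ℕ) (t : Fin n → ℕ), |q k - a * (1 / ((b : ℝ) + 1))| < 1 / ((k : ℝ) + 1) ∧
      |X - (posRatCode s : ℝ) ^ (b + 1)| < 1 / ((k : ℝ) + 1) ∧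
      (∀ j, |x j - (posRatCode (t j) : ℝ) ^ (b + 1)| < 1 / ((k : ℝ) + 1)) ∧
      |(posRatCode s : ℝ) ^ a - ∑ j, (posRatCode (t j) : ℝ) ^ a| < 1 / ((k : ℝ) + 1)) :
    X ^ p = ∑ j, x j ^ p := by
  choose a b s t h1 h2 h3 h4 using H
  have hp0 : 0 < p := by linarith
  have hlim := tendsto_one_div_add_atTop_nhds_zero_nat (𝕜 := ℝ)
  have key : ∀ {f g : ℕ → ℝ} {l : ℝ}, (∀ k : ℕ, |g k - f k| < 1 / ((k : ℝ) + 1)) →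
      Tendsto g atTop (𝓝 l) → Tendsto f atTop (𝓝 l) := fun {f g l} hfg hg => by
    have h0 : Tendsto (fun k => g k - f k) atTop (𝓝 0) :=
      squeeze_zero_norm (fun k => (hfg k).le) hlim
    simpa using hg.sub h0
  have he := key h1 hq
  have hX := (key h2 tendsto_const_nhds).rpow he (Or.inr hp0)
  have hx := tendsto_finsetSum Finset.univ fun j _ =>
    (key (fun k => h3 k j) tendsto_const_nhds).rpow he (Or.inr hp0)
  have hdiff := hX.sub hx
  simp only [pow_rpow_natCast_div (posRatCode_cast_pos _).le] at hdiff
  have h0 : Tendsto (fun k => (posRatCode (s k) : ℝ) ^ a k -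
      ∑ j, (posRatCode (t k j) : ℝ) ^ a k) atTop (𝓝 0) :=
    squeeze_zero_norm (fun k => (h4 k).le) hlim
  exact sub_eq_zero.1 (tendsto_nhds_unique hdiff h0)

theorem inv_two_pow_le_one_div (k : ℕ) : (2 : ℝ)⁻¹ ^ k ≤ 1 / ((k : ℝ) + 1) := by
  have h : (k : ℝ) + 1 ≤ 2 ^ k := by exact_mod_cast Nat.lt_two_pow_self
  rw [inv_pow, ← one_div]
  exact one_div_le_one_div_of_le (by positivity) h

theorem NamesReal.tendsto {h : ℕ → ℕ} {p : ℝ} (hh : NamesReal h p) :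
    Tendsto (fun k => (ratCode (h k) : ℝ)) atTop (𝓝 p) := by
  rw [tendsto_iff_norm_sub_tendsto_zero]
  exact squeeze_zero (fun k => norm_nonneg _)
    (fun k => ((hh k).trans_le (inv_two_pow_le_one_div k)).le)
    (tendsto_one_div_add_atTop_nhds_zero_nat (𝕜 := ℝ))

theorem exists_ofFn_of_map_fst {α β : Type*} {n : ℕ} {l : Fin n → α} {W : List (α × β)}
    (h : W.map Prod.fst = List.ofFn l) : ∃ t : Fin n → β, W = List.ofFn fun j => (l j, t j) := by
  have hn : W.length = n := by simpa using congrArg List.length h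
  subst hn
  refine ⟨fun j => (W.get j).2, List.ext_getElem (by simp) fun i h1 h2 => ?_⟩
  have := List.getElem_of_eq h (i := i) (by simpa using h1)
  simp only [List.getElem_map, List.getElem_ofFn] at this
  simp [← this]

/-! ### Unconditional sums with monotone partial sums -/

/-- Let the sum over `s` be within `ε / 3` of `w`. For `t ⊇ s` choose `r ⊇ t` whose sum is also that
close. Since `t \ s ⊆ r \ s`, monotonicity bounds the difference of the sums over `t` and `s` by
that for `r` and `s`, which is below `2ε / 3`. -/
theorem hasSum_of_norm_sum_mono {ι B : Type*} [NormedAddCommGroup B] {f : ι → B} {w : B}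
    (hmono : ∀ s t : Finset ι, s ⊆ t → ‖∑ i ∈ s, f i‖ ≤ ‖∑ i ∈ t, f i‖)
    (hclust : ∀ (s : Finset ι) (ε : ℝ), 0 < ε → ∃ t, s ⊆ t ∧ ‖∑ i ∈ t, f i - w‖ < ε) :
    HasSum f w := by
  classical
  rw [HasSum, SummationFilter.unconditional_filter, Metric.tendsto_atTop]
  intro ε hε
  have hε' : 0 < ε / 3 := by positivity
  obtain ⟨s, -, hs⟩ := hclust ∅ _ hε'
  refine ⟨s, fun t hst => ?_⟩
  obtain ⟨r, htr, hr⟩ := hclust t _ hε'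
  have h1 : ∑ i ∈ t, f i - ∑ i ∈ s, f i = ∑ i ∈ t \ s, f i := by
    rw [← Finset.sum_sdiff hst, add_sub_cancel_right]
  have h2 : ∑ i ∈ r, f i - ∑ i ∈ s, f i = ∑ i ∈ r \ s, f i := by
    rw [← Finset.sum_sdiff (hst.trans htr), add_sub_cancel_right]
  have h3 := hmono _ _ (Finset.sdiff_subset_sdiff htr (Finset.Subset.refl s))
  rw [← h1, ← h2] at h3
  have h4 := norm_sub_le_norm_sub_add_norm_sub (∑ i ∈ t, f i) (∑ i ∈ s, f i) w
  have h5 := norm_sub_le_norm_sub_add_norm_sub (∑ i ∈ r, f i) w (∑ i ∈ s, f i)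
  rw [norm_sub_rev w] at h5
  rw [dist_eq_norm]
  linarith

section Correctness

variable {𝕜 : Type u} [RCLike 𝕜] {B : Type v} [NormedAddCommGroup B] [NormedSpace 𝕜 B]
  {R : ℕ → B} {C : VectorArithmetic.{v} 𝕜} {F : Fin 3 → ℕ → ℕ} {p : ℝ} {φ : VectorTree B}

/-! ### Formal disjointness -/

variable (𝕜) in
-- Both sides are continuous in the scalars, and tuples of rational scalars are dense.
theorem formallyDisjoint_iff_scalarCode (hp : 1 ≤ p) {n : ℕ} {w : Fin n → B} :
    FormallyDisjoint 𝕜 p w ↔ ∀ a : Fin n → ℕ, ‖∑ j, scalarCode 𝕜 (a j) • w j‖ ^ p =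
      ∑ j, ‖scalarCode 𝕜 (a j) • w j‖ ^ p := by
  have hmul : ∀ (x : 𝕜) (y : B), ‖x • y‖ ^ p = ‖x‖ ^ p * ‖y‖ ^ p := fun x y => by
    rw [norm_smul, Real.mul_rpow (norm_nonneg _) (norm_nonneg _)]
  have hp0 : 0 ≤ p := by linarith
  simp only [FormallyDisjoint, hmul]
  refine ⟨fun H a => H _, fun H => ?_⟩
  have hd : DenseRange fun (a : Fin n → ℕ) j => scalarCode 𝕜 (a j) :=
    DenseRange.piMap fun _ => denseRange_scalarCode 𝕜
  refine congrFun (hd.equalizer ?_ ?_ (funext H))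
  · exact (Continuous.norm (by fun_prop)).rpow_const fun _ => Or.inr hp0
  · refine continuous_finsetSum _ fun j _ => Continuous.mul ?_ continuous_const
    exact (continuous_apply j).norm.rpow_const fun _ => Or.inr hp0

theorem comb_ofFn (vec : List ℕ → B) {n : ℕ} (l : Fin n → List ℕ × ℕ) :
    comb 𝕜 vec (List.ofFn l) = ∑ j, scalarCode 𝕜 (l j).2 • vec (l j).1 := by
  rw [comb, List.map_ofFn, List.sum_ofFn]
  rfl

theorem powerApprox_iff (hR : IsPresentation 𝕜 R) (hF : NamesPresentation 𝕜 (F 0) R)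
    (hG : ListsGraph 𝕜 F R φ.dom φ.vec) (hp : 1 ≤ p) (hh : NamesReal (F 2) p) {n : ℕ}
    {l : Fin n → List ℕ × ℕ} (hl : ∀ j, (l j).1 ∈ φ.dom) :
    (∀ k, PowerApprox C F (List.ofFn l) k) ↔ ‖comb 𝕜 φ.vec (List.ofFn l)‖ ^ p =
      ∑ j, ‖scalarCode 𝕜 (l j).2 • φ.vec (l j).1‖ ^ p := by
  have hone : ∀ e : List ℕ × ℕ, comb 𝕜 φ.vec [e] = scalarCode 𝕜 e.2 • φ.vec e.1 := fun e => by
    simp [comb]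
  constructor
  · intro H
    refine pow_eq_of_approx hp hh.tendsto fun k => ?_
    obtain ⟨⟨c, a, b, s, W⟩, rfl, h1, h2, h3, h4, h5⟩ := H k
    dsimp only at h1 h2 h3 h4 h5
    obtain ⟨t, rfl⟩ := exists_ofFn_of_map_fst h2
    rw [combNorm_iff hR hF hG, ratVec_encode_nil, zero_add] at h3
    simp only [combNorm_iff hR hF hG, ratVec_encode_nil, zero_add, hone] at h4
    have h1 := Rat.cast_lt (K := ℝ).2 h1
    have h5 := Rat.cast_lt (K := ℝ).2 h5
    rw [List.map_ofFn, List.sum_ofFn] at h5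
    have h3 := h3.2
    push_cast at h1 h3 h5
    refine ⟨a, b, s, t, h1, h3, fun j => ?_, by simpa using h5⟩
    have := (h4 (l j, t j) (List.mem_ofFn.2 ⟨j, rfl⟩)).2
    push_cast at this
    exact this
  · intro H k
    obtain ⟨a, b, s, t, h1, h2, h3, h4⟩ := exists_pow_approx hp (norm_nonneg _)
      (fun j => norm_nonneg _) H ((hh k).trans_le (inv_two_pow_le_one_div k))
    refine ⟨(F 2 k, a, b, s, List.ofFn fun j => (l j, t j)), rfl, ?_, ?_, ?_, ?_, ?_⟩
    · refine Rat.cast_lt (K := ℝ).1 ?_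
      push_cast
      exact h1
    · rw [List.map_ofFn]
      rfl
    · rw [combNorm_iff hR hF hG, ratVec_encode_nil, zero_add]
      refine ⟨fun e he => ?_, ?_⟩
      · obtain ⟨j, rfl⟩ := List.mem_ofFn.1 he
        exact hl j
      · push_cast
        exact h2
    · intro e he
      obtain ⟨j, rfl⟩ := List.mem_ofFn.1 he
      rw [combNorm_iff hR hF hG, ratVec_encode_nil, zero_add, hone]
      refine ⟨by simpa using hl j, ?_⟩
      push_cast
      exact h3 j
    · refine Rat.cast_lt (K := ℝ).1 ?_
      rw [List.map_ofFn, List.sum_ofFn]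
      push_cast
      simpa using h4

theorem incomparable_ofFn {n : ℕ} {l : Fin n → List ℕ × ℕ} :
    Incomparable (List.ofFn l) ↔ ∀ i j, i ≠ j → ¬ (l i).1 <+: (l j).1 := by
  rw [Incomparable, List.pairwise_ofFn]
  constructor
  · intro H i j hij
    rcases lt_or_gt_of_ne hij with h | h
    · exact (H h).1
    · exact (H h).2
  · intro H i j hij
    exact ⟨H i j hij.ne, H j i hij.ne'⟩

theorem separatingCond_iff (hR : IsPresentation 𝕜 R) (hF : NamesPresentation 𝕜 (F 0) R)
    (hG : ListsGraph 𝕜 F R φ.dom φ.vec) (hp : 1 ≤ p) (hh : NamesReal (F 2) p) :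
    SeparatingCond C F ↔ φ.FormallySeparating 𝕜 p := by
  constructor
  · intro H n ν hν hinc
    rw [formallyDisjoint_iff_scalarCode 𝕜 hp]
    intro a
    have := (powerApprox_iff (C := C) hR hF hG hp hh (l := fun j => (ν j, a j)) hν).1 fun k =>
      H (_, k) ⟨fun e he => by
        obtain ⟨j, rfl⟩ := List.mem_ofFn.1 he
        exact (hG.onTree_iff hR).2 (hν j), incomparable_ofFn.2 hinc⟩
    rwa [comb_ofFn] at this
  · rintro H ⟨L, k⟩ ⟨hL, hinc⟩
    obtain ⟨n, l, rfl⟩ : ∃ (n : ℕ) (l : Fin n → List ℕ × ℕ), L = List.ofFn l :=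
      ⟨_, L.get, (List.ofFn_get L).symm⟩
    have hl : ∀ j, (l j).1 ∈ φ.dom := fun j =>
      (hG.onTree_iff hR).1 (hL _ (List.mem_ofFn.2 ⟨j, rfl⟩))
    refine (powerApprox_iff hR hF hG hp hh hl).2 ?_ k
    rw [comb_ofFn]
    exact (formallyDisjoint_iff_scalarCode 𝕜 hp).1
      (H n (fun j => (l j).1) hl (incomparable_ofFn.1 hinc)) fun j => (l j).2

/-- Distinct children of a node have the same length and hence are incomparable; formal disjointness
is applied with all scalars equal to `1`. -/
theorem norm_sum_rpow_eq (hsep : φ.FormallySeparating 𝕜 p) {ν : List ℕ}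
    (s : Finset {a // ν ++ [a] ∈ φ.dom}) :
    ‖∑ a ∈ s, φ.vec (ν ++ [a.1])‖ ^ p = ∑ a ∈ s, ‖φ.vec (ν ++ [a.1])‖ ^ p := by
  have e := s.equivFin.symm
  have h := hsep _ (fun j => ν ++ [(e j).1.1]) (fun j => (e j).1.2) (fun i j hij hpre => by
    have := hpre.eq_of_length (by simp)
    simp only [List.append_cancel_left_eq, List.cons.injEq, and_true] at this
    exact hij (e.injective (Subtype.ext (Subtype.ext this)))) (fun _ => 1)
  simp only [one_smul, norm_one, Real.one_rpow, one_mul] at h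
  rw [← Finset.sum_coe_sort s, ← Finset.sum_coe_sort s (fun a => ‖φ.vec (ν ++ [a.1])‖ ^ p),
    ← e.sum_comp, ← e.sum_comp]
  exact h

theorem norm_sum_mono (hp : 1 ≤ p) (hsep : φ.FormallySeparating 𝕜 p) {ν : List ℕ}
    (s t : Finset {a // ν ++ [a] ∈ φ.dom}) (hst : s ⊆ t) :
    ‖∑ a ∈ s, φ.vec (ν ++ [a.1])‖ ≤ ‖∑ a ∈ t, φ.vec (ν ++ [a.1])‖ := by
  rw [← Real.rpow_le_rpow_iff (norm_nonneg _) (norm_nonneg _) (by linarith : 0 < p),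
    norm_sum_rpow_eq hsep, norm_sum_rpow_eq hsep]
  exact Finset.sum_le_sum_of_subset_of_nonneg hst fun _ _ _ => Real.rpow_nonneg (norm_nonneg _) _

theorem hasSum_children_iff {ν : List ℕ} {w : B} :
    HasSum (fun μ : φ.children ν => φ.vec μ) w ↔
      HasSum (fun a : {a // ν ++ [a] ∈ φ.dom} => φ.vec (ν ++ [a.1])) w := by
  let e : {a // ν ++ [a] ∈ φ.dom} ≃ φ.children ν := Equiv.ofBijective
    (fun a => ⟨ν ++ [a.1], a.2, a.1, rfl⟩) ⟨fun a b hab => by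
      have := congrArg Subtype.val hab
      simpa [Subtype.ext_iff] using this, by
      rintro ⟨_, h, a, rfl⟩
      exact ⟨⟨a, h⟩, rfl⟩⟩
  rw [← e.hasSum_iff]
  rfl

theorem comb_childrenComb (C : VectorArithmetic.{v} 𝕜) (vec : List ℕ → B) (ν : List ℕ) (E : List ℕ) :
    comb 𝕜 vec (childrenComb C ν E) = (E.map fun a => vec (ν ++ [a])).sum - vec ν := by
  have : comb 𝕜 vec (childrenComb C ν E) =
      -vec ν + (E.map fun a => scalarCode 𝕜 C.one • vec (ν ++ [a])).sum := by
    simp [comb, childrenComb, C.scalarCode_negOne, Function.comp_def]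
  rw [this, C.scalarCode_one]
  simp only [one_smul]
  abel

/-- The condition says that the vector at a node is a cluster point of the finite sums over its
children. Separation enters only to turn this into convergence. -/
theorem summativeCond_iff (hR : IsPresentation 𝕜 R) (hF : NamesPresentation 𝕜 (F 0) R)
    (hG : ListsGraph 𝕜 F R φ.dom φ.vec) (hp : 1 ≤ p) (hsep : φ.FormallySeparating 𝕜 p) :
    SummativeCond C F ↔ φ.Summative := by
  classical
  simp only [SummativeCond, combNorm_iff hR hF hG, hG.onTree_iff hR, ratVec_encode_nil, zero_add,
    comb_childrenComb, VectorTree.Summative, hasSum_children_iff]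
  constructor
  · rintro H ν - ⟨_, ha, a, rfl⟩
    refine hasSum_of_norm_sum_mono (norm_sum_mono hp hsep) fun s ε hε => ?_
    obtain ⟨k, hk⟩ := exists_nat_one_div_lt hε
    obtain ⟨E, hnd, hsub, hdom, hlt⟩ := H (ν, (s.image Subtype.val).toList, k) ⟨⟨a, ha⟩, by
      simp +contextual⟩
    dsimp only at hsub hdom hlt
    have hE : ∀ b ∈ E, ν ++ [b] ∈ φ.dom := fun b hb => hdom (ν ++ [b], C.one) (by
      simp [childrenComb, hb])
    refine ⟨E.toFinset.subtype fun b => ν ++ [b] ∈ φ.dom, fun b hb => ?_, ?_⟩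
    · rw [Finset.mem_subtype, List.mem_toFinset]
      exact hsub _ (by simpa using ⟨b.2, hb⟩)
    · rw [Finset.sum_subtype_of_mem (fun b => φ.vec (ν ++ [b])) (by simpa using hE),
        List.sum_toFinset _ hnd]
      push_cast at hlt
      rw [sub_zero, abs_norm] at hlt
      exact hlt.trans hk
  · rintro H ⟨ν, E₀, k⟩ ⟨⟨a, ha⟩, hE₀⟩
    dsimp only at ha hE₀ ⊢
    have hν : ν ∈ φ.dom := φ.isTree _ ha _ (List.prefix_append _ _)
    have hs := H ν hν ⟨_, ha, a, rfl⟩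
    rw [HasSum, SummationFilter.unconditional_filter, Metric.tendsto_atTop] at hs
    obtain ⟨s, hs⟩ := hs _ (Nat.one_div_pos_of_nat (n := k))
    -- Beyond `s` all finite sums are close, so the prescribed children may be adjoined freely.
    set t := s ∪ E₀.toFinset.subtype (fun b => ν ++ [b] ∈ φ.dom) with ht
    refine ⟨(t.image Subtype.val).toList, Finset.nodup_toList _, fun b hb => ?_, ?_, ?_⟩
    · rw [Finset.mem_toList, Finset.mem_image]
      exact ⟨⟨b, hE₀ b hb⟩, by simp [ht, hb], rfl⟩
    · intro e he
      simp only [childrenComb, List.mem_cons, List.mem_map, Finset.mem_toList] at he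
      rcases he with rfl | ⟨b, hb, rfl⟩
      · exact hν
      · obtain ⟨c, -, rfl⟩ := Finset.mem_image.1 hb
        exact c.2
    · have := hs t Finset.subset_union_left
      rw [dist_eq_norm] at this
      rw [Finset.sum_map_toList, Finset.sum_image Subtype.val_injective.injOn]
      push_cast
      rwa [sub_zero, abs_norm]

/-! ### The remaining conditions -/

theorem nonzeroCond_iff (hR : IsPresentation 𝕜 R) (hF : NamesPresentation 𝕜 (F 0) R)
    (hG : ListsGraph 𝕜 F R φ.dom φ.vec) : NonzeroCond C F ↔ ∀ ν ∈ φ.dom, φ.vec ν ≠ 0 := by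
  simp only [NonzeroCond, combNorm_iff hR hF hG, hG.onTree_iff hR, ratVec_encode_nil, zero_add]
  refine forall₂_congr fun ν hν => ?_
  have : comb 𝕜 φ.vec [(ν, C.one)] = φ.vec ν := by simp [comb, C.scalarCode_one]
  rw [this, ← norm_pos_iff, ← exists_posRatCode_abs_sub_lt_iff]
  simp [hν]

/-- Stated for bare `dom` and `vec`, because injectivity is needed before a `VectorTree` can be
formed. -/
theorem injectiveCond_iff (hR : IsPresentation 𝕜 R) (hF : NamesPresentation 𝕜 (F 0) R)
    {dom : Set (List ℕ)} {vec : List ℕ → B} (hG : ListsGraph 𝕜 F R dom vec) :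
    InjectiveCond C F ↔ Set.InjOn vec dom := by
  simp only [InjectiveCond, combNorm_iff hR hF hG, hG.onTree_iff hR, ratVec_encode_nil, zero_add]
  have hcomb : ∀ ν μ, comb 𝕜 vec [(ν, C.one), (μ, C.negOne)] = vec ν - vec μ := fun ν μ => by
    simp [comb, C.scalarCode_one, C.scalarCode_negOne, sub_eq_add_neg]
  simp only [hcomb, exists_and_left, exists_posRatCode_abs_sub_lt_iff, norm_pos_iff, sub_ne_zero]
  constructor
  · intro H ν hν μ hμ heq
    by_contra hne
    exact (H (ν, μ) ⟨hν, hμ, hne⟩).2 heq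
  · rintro H ⟨ν, μ⟩ ⟨hν, hμ, hne⟩
    exact ⟨by simp [hν, hμ], fun heq => hne (H hν hμ heq)⟩

theorem denseCond_iff (hR : IsPresentation 𝕜 R) (hF : NamesPresentation 𝕜 (F 0) R)
    (hG : ListsGraph 𝕜 F R φ.dom φ.vec) :
    DenseCond C F ↔ LinearlyDense 𝕜 (φ.vec '' φ.dom) := by
  simp only [DenseCond, combNorm_iff hR hF hG, true_imp_iff, Rat.cast_zero, sub_zero, abs_norm]
  push_cast
  constructor
  · intro H
    have hspan : ∀ L : List (List ℕ × ℕ), (∀ e ∈ L, e.1 ∈ φ.dom) →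
        comb 𝕜 φ.vec L ∈ Submodule.span 𝕜 (φ.vec '' φ.dom) := fun L hL => by
      refine list_sum_mem fun x hx => ?_
      obtain ⟨e, he, rfl⟩ := List.mem_map.1 hx
      exact Submodule.smul_mem _ _ (Submodule.subset_span ⟨_, hL e he, rfl⟩)
    have hsub : Set.range (ratVec 𝕜 R) ⊆
        closure (Submodule.span 𝕜 (φ.vec '' φ.dom) : Set B) := by
      rintro _ ⟨c, rfl⟩
      rw [Metric.mem_closure_iff]
      intro ε hε
      obtain ⟨k, hk⟩ := exists_nat_one_div_lt hε
      obtain ⟨L, hL, hlt⟩ := H (c, k)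
      -- `DenseCond` makes the sum of the rational vector and the combination small, hence the sign.
      refine ⟨-comb 𝕜 φ.vec L, Submodule.neg_mem _ (hspan L hL), ?_⟩
      rw [dist_eq_norm, sub_neg_eq_add]
      exact hlt.trans hk
    intro x
    exact closure_minimal hsub isClosed_closure (denseRange_ratVec hR x)
  · rintro H ⟨c, k⟩
    obtain ⟨m, _, hm⟩ := exists_scalarMul 𝕜
    have hsub := span_subset_closure (𝕜 := 𝕜) (s := φ.vec '' φ.dom)
      (A := {x | ∃ L, (∀ e ∈ L, e.1 ∈ φ.dom) ∧ comb 𝕜 φ.vec L = x}) ⟨[], by simp [comb]⟩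
      (by
        rintro _ ⟨ν, hν, rfl⟩
        exact ⟨[(ν, C.one)], by simpa using hν, by simp [comb, C.scalarCode_one]⟩)
      (by
        rintro _ ⟨L, hL, rfl⟩ _ ⟨L', hL', rfl⟩
        refine ⟨L ++ L', fun e he => ?_, by simp [comb]⟩
        rcases List.mem_append.1 he with h | h
        exacts [hL e h, hL' e h])
      (by
        rintro n _ ⟨L, hL, rfl⟩
        refine ⟨L.map fun e => (e.1, m n e.2), fun e he => ?_, ?_⟩
        · obtain ⟨e', he', rfl⟩ := List.mem_map.1 he
          exact hL e' he'
        · simp [comb, hm, mul_smul, List.smul_sum, Function.comp_def])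
    have hx := closure_minimal hsub isClosed_closure (H (-ratVec 𝕜 R c))
    obtain ⟨_, ⟨L, hL, rfl⟩, hlt⟩ := Metric.mem_closure_iff.1 hx _ (Nat.one_div_pos_of_nat (n := k))
    refine ⟨L, hL, ?_⟩
    rwa [dist_eq_norm, ← neg_add', norm_neg] at hlt

/-! ### The conditions characterize names of formal disintegrations. -/

theorem cond_iff [CompleteSpace B] (C : VectorArithmetic.{v} 𝕜) (hR : IsPresentation 𝕜 R)
    (hF : NamesPresentation 𝕜 (F 0) R) (hp : 1 ≤ p) (hh : NamesReal (F 2) p) :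
    (TreeNameCond C F ∧ DisintegrationCond C F) ↔
      ∃ φ : VectorTree B, φ.IsFormalDisintegration 𝕜 p ∧ φ.Names 𝕜 (F 1) R := by
  constructor
  · rintro ⟨htree, hsep, hsum, hnz, hinj, hdense⟩
    obtain ⟨vec, hG⟩ := exists_vec_of_treeNameCond hF htree
    -- `TreeCond` deletes one last entry; iterating it reaches every initial segment.
    have hpre : ∀ ν μ : List ℕ, OnTree F (μ ++ ν) → OnTree F μ := fun ν μ => by
      induction ν using List.reverseRecOn with
      | nil => simp
      | append_singleton ν a ih =>
        intro h
        rw [← List.append_assoc] at h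
        exact ih (htree.2.1 (μ ++ ν, a) h)
    let φ : VectorTree B :=
      { dom := {ν | OnTree F ν}
        vec := vec
        isTree := by
          rintro _ h μ ⟨ν, rfl⟩
          exact hpre ν μ h
        inj := (injectiveCond_iff hR hF hG).1 hinj }
    have hG' : ListsGraph 𝕜 F R φ.dom φ.vec := hG
    have hsep' := (separatingCond_iff hR hF hG' hp hh).1 hsep
    exact ⟨φ, ⟨(summativeCond_iff hR hF hG' hp hsep').1 hsum, hsep',
      (nonzeroCond_iff hR hF hG').1 hnz, (denseCond_iff hR hF hG').1 hdense⟩,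
      (names_iff rfl hG').2 htree.1⟩
  · rintro ⟨φ, ⟨hsum, hsep, hnz, hdense⟩, hname⟩
    have hG := listsGraph_of_names rfl hname
    exact ⟨treeNameCond_of_names hR hF hname, (separatingCond_iff hR hF hG hp hh).2 hsep,
      (summativeCond_iff hR hF hG hp hsep).2 hsum, (nonzeroCond_iff hR hF hG).2 hnz,
      (injectiveCond_iff hR hF hG).2 φ.inj, (denseCond_iff hR hF hG).2 hdense⟩

end Correctness

end FormalDisint

theorem mainTheorem8 (𝕜 : Type*) [RCLike 𝕜] :
    ∃ Disint : (Fin 3 → ℕ → ℕ) → Prop, FormalDisint.IsPi02 Disint ∧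
      ∀ (f g h : ℕ → ℕ) (B : Type*) [NormedAddCommGroup B] [NormedSpace 𝕜 B] [CompleteSpace B]
        (R : ℕ → B) (p : ℝ), FormalDisint.IsPresentation 𝕜 R →
        FormalDisint.NamesPresentation 𝕜 f R → 1 ≤ p → FormalDisint.NamesReal h p →
        (Disint ![f, g, h] ↔
          ∃ φ : FormalDisint.VectorTree B,
            φ.IsFormalDisintegration 𝕜 p ∧ φ.Names 𝕜 g R) := by
  -- The arithmetic on codes is fixed before the names, the space and `p`, so the predicate depends
  -- on `𝕜` only.
  obtain ⟨C⟩ := FormalDisint.nonempty_vectorArithmetic 𝕜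
  exact ⟨_, FormalDisint.isPi02_cond C, fun f g h B _ _ _ R p hR hf hp hh =>
    FormalDisint.cond_iff (F := ![f, g, h]) C hR hf hp hh⟩
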